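/- Let $(M^{2n+1},\phi,\xi,\eta,g)$ be a Sasaki manifold, i.e. a smooth Riemannian manifold $(M,g)$ of dimension $2n+1$ with a smooth $(1,1)$-tensor field $\phi$, vector field $\xi$ and $1$-form $\eta$ such that $$\phi^2=-I+\eta\otimes\xi,\qquad \eta(\xi)=1,\qquad g(\phi X,\phi Y)=g(X,Y)-\eta(X)\eta(Y),$$ $\eta\wedge(d\eta)^n\neq0$ everywhere, $d\eta(X,Y)=g(X,\phi Y)$ and $[\phi,\phi](X,Y)+2\,d\eta(X,Y)\,\xi=0$, where $d\eta(X,Y)=\frac12\big(X\eta(Y)-Y\eta(X)-\eta([X,Y])\big)$ and $[\phi,\phi](X,Y)=\phi^2[X,Y]+[\phi X,\phi Y]-\phi[\phi X,Y]-\phi[X,\phi Y]$. Let $\mathcal V\subset TM$ be a smooth distribution of dimension $2p+1$ that is invariant ($\phi(\mathcal V)\subseteq\mathcal V$) and contact-holomorphic: around every point it has a local frame of smooth vector fields $X$ with $(\mathcal L_X\phi)Y=\eta([X,\phi Y])\,\xi$ for all $Y$. Put $\mathcal H=\mathcal V^\perp$. Let $\nabla$ be the Levi-Civita connection. For $\mathcal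 D=\mathcal V$ or $\mathcal D=\mathcal H$, and sections $X,Y$ of $\mathcal D$, let $$B^{\mathcal D}(X,Y)=\tfrac12\big(\nabla_XY+\nabla_YX\big)^{\mathcal D^\perp},\qquad I^{\mathcal D}(X,Y)=[X,Y]^{\mathcal D^\perp},$$ where the exponent denotes orthogonal projection. For local orthonormal frames $\{e_i\}$ of $\mathcal V$ and $\{f_\alpha\}$ of $\mathcal H$ let $$\mathrm{trace}\,B^{\mathcal H}=\sum_\alpha B^{\mathcal H}(f_\alpha,f_\alpha),\quad |B^{\mathcal V}|^2=\sum_{i,j}|B^{\mathcal V}(e_i,e_j)|^2,\quad |I^{\mathcal V}|^2=\sum_{i,j}|I^{\mathcal V}(e_i,e_j)|^2,$$ $$\mathrm{div}^{\mathcal V}W=\sum_i g(\nabla_{e_i}W,e_i),\qquad s_{mix}=\sum_{i,\alpha}K(e_i\wedge f_\alpha),$$ with $K$ the sectional curvature of $g$. Then $\mathrm{trace}\,B^{\mathcal H}$ is a smooth vector field, and at every point of $M$ $$\mathrm{div}^{\mathcal V}\,\mathrm{trace}\,B^{\mathcal H}+2(n-p)+\tfrac14|I^{\mathcal V}|^2=s_{mix}+|B^{\mathcal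 V}|^2 .$$ If moreover $\mathcal V$ is integrable (tangent to a foliation, i.e. locally the kernel of the differential of a smooth submersion), then at every point $$\mathrm{div}^{\mathcal V}\,\mathrm{trace}\,B^{\mathcal H}+2(n-p)=s_{mix}+|B^{\mathcal V}|^2 .$$ -/

import Mathlib

open Bundle FiberBundle VectorField Module
open scoped Manifold ContDiff

namespace SasakiWalczak

noncomputable section

/-! ### The Levi-Civita connection -/

variable {E : Type*} [NormedAddCommGroup E] [NormedSpace ℝ E] [FiniteDimensional ℝ E]
  {H : Type*} [TopologicalSpace H] {I : ModelWithCorners ℝ E H}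
  {M : Type*} [TopologicalSpace M] [ChartedSpace H M] [IsManifold I ∞ M]
  [RiemannianBundle (fun x : M ↦ TangentSpace I x)]
  [IsContMDiffRiemannianBundle I ∞ E (fun x : M ↦ TangentSpace I x)]

instance tangentSpace_finiteDimensional (x : M) : FiniteDimensional ℝ (TangentSpace I x) :=
  inferInstanceAs (FiniteDimensional ℝ E)

instance tangentSpace_completeSpace (x : M) : CompleteSpace (TangentSpace I x) := FiniteDimensional.complete ℝ _

/-- Half of the right-hand side of the Koszul formula, so that `g(∇_X Y, Z) = koszul X Y Z`. -/
def koszul (X Y Z : Π x : M, TangentSpace I x) (x : M) : ℝ :=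
  (mvfderiv I (fun y ↦ inner ℝ (Y y) (Z y)) x (X x)
    + mvfderiv I (fun y ↦ inner ℝ (Z y) (X y)) x (Y x)
    - mvfderiv I (fun y ↦ inner ℝ (X y) (Y y)) x (Z x)
    + inner ℝ (mlieBracket I X Y x) (Z x)
    - inner ℝ (mlieBracket I Y Z x) (X x)
    + inner ℝ (mlieBracket I Z X x) (Y x)) / 2

variable {X X' Y Y' Z : Π x : M, TangentSpace I x} {x : M}

theorem mdifferentiableAt_inner (hY : MDiffAt (T% Y) x) (hZ : MDiffAt (T% Z) x) :
    MDiffAt (fun y ↦ inner ℝ (Y y) (Z y)) x :=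
  MDifferentiableAt.inner_bundle (F := E) (E := fun x : M ↦ TangentSpace I x) hY hZ

theorem koszul_tensorial_left (hY : MDiffAt (T% Y) x) (hZ : MDiffAt (T% Z) x) :
    TensorialAt I E (fun X ↦ koszul X Y Z x) x where
  smul {f X} hf hX := by
    have : CompleteSpace E := FiniteDimensional.complete ℝ E
    simp [koszul, mvfderiv_fun_mul hf (mdifferentiableAt_inner hZ hX), mvfderiv_fun_mul hf (mdifferentiableAt_inner hX hY),
      mlieBracket_smul_left hf hX, mlieBracket_smul_right hf hX, inner_add_left, inner_smul_left,
      inner_smul_right]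
    rw [real_inner_comm (X x) (Z x)]
    ring
  add {X X'} hX hX' := by
    have : CompleteSpace E := FiniteDimensional.complete ℝ E
    simp [koszul, inner_add_left, inner_add_right,
      mvfderiv_fun_add (mdifferentiableAt_inner hZ hX) (mdifferentiableAt_inner hZ hX'),
      mvfderiv_fun_add (mdifferentiableAt_inner hX hY) (mdifferentiableAt_inner hX' hY),
      mlieBracket_add_left hX hX', mlieBracket_add_right hX hX']
    ring

theorem koszul_tensorial_right (hX : MDiffAt (T% X) x) (hY : MDiffAt (T% Y) x) :
    TensorialAt I E (fun Z ↦ koszul X Y Z x) x where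
  smul {f Z} hf hZ := by
    have : CompleteSpace E := FiniteDimensional.complete ℝ E
    simp [koszul, mvfderiv_fun_mul hf (mdifferentiableAt_inner hZ hX), mvfderiv_fun_mul hf (mdifferentiableAt_inner hY hZ),
      mlieBracket_smul_left hf hZ, mlieBracket_smul_right hf hZ, inner_add_left, inner_smul_left,
      inner_smul_right]
    rw [real_inner_comm (X x) (Z x), real_inner_comm (Z x) (Y x)]
    ring
  add {Z Z'} hZ hZ' := by
    have : CompleteSpace E := FiniteDimensional.complete ℝ E
    simp [koszul, inner_add_left, inner_add_right,
      mvfderiv_fun_add (mdifferentiableAt_inner hZ hX) (mdifferentiableAt_inner hZ' hX),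
      mvfderiv_fun_add (mdifferentiableAt_inner hY hZ) (mdifferentiableAt_inner hY hZ'),
      mlieBracket_add_left hZ hZ', mlieBracket_add_right hZ hZ']
    ring

theorem koszul_add_middle (hX : MDiffAt (T% X) x) (hY : MDiffAt (T% Y) x)
    (hY' : MDiffAt (T% Y') x) (hZ : MDiffAt (T% Z) x) :
    koszul X (Y + Y') Z x = koszul X Y Z x + koszul X Y' Z x := by
  have : CompleteSpace E := FiniteDimensional.complete ℝ E
  simp [koszul, inner_add_left, inner_add_right,
    mvfderiv_fun_add (mdifferentiableAt_inner hY hZ) (mdifferentiableAt_inner hY' hZ),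
    mvfderiv_fun_add (mdifferentiableAt_inner hX hY) (mdifferentiableAt_inner hX hY'),
    mlieBracket_add_left hY hY', mlieBracket_add_right hY hY']
  ring

theorem koszul_smul_middle {f : M → ℝ} (hf : MDiffAt f x) (hX : MDiffAt (T% X) x)
    (hY : MDiffAt (T% Y) x) (hZ : MDiffAt (T% Z) x) :
    koszul X (f • Y) Z x
      = f x * koszul X Y Z x + mvfderiv I f x (X x) * inner ℝ (Y x) (Z x) := by
  have : CompleteSpace E := FiniteDimensional.complete ℝ E
  simp [koszul, mvfderiv_fun_mul hf (mdifferentiableAt_inner hY hZ), mvfderiv_fun_mul hf (mdifferentiableAt_inner hX hY),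
    mlieBracket_smul_left hf hY, mlieBracket_smul_right hf hY, inner_add_left, inner_smul_left,
    inner_smul_right]
  rw [real_inner_comm (X x) (Y x)]
  ring

open scoped Classical in
/-- The Levi-Civita derivative `v ↦ ∇_v Y` of a vector field `Y` at a point `x` where `Y` is
differentiable: the vector `∇_v Y` represents the functional `w ↦ koszul v Y w` (which is tensorial
in `v` and `w`). As usual the value at points of non-differentiability is set to `0`. -/
def leviCivitaAux (Y : Π x : M, TangentSpace I x) (x : M) :
    TangentSpace I x →L[ℝ] TangentSpace I x :=
  if hY : MDiffAt (T% Y) x then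
    LinearMap.toContinuousLinearMap
      { toFun := fun v ↦ (InnerProductSpace.toDual ℝ (TangentSpace I x)).symm
          (TensorialAt.mkHom₂ (fun X Z ↦ koszul X Y Z x) x
            (fun _ hZ ↦ koszul_tensorial_left hY hZ)
            (fun _ hX ↦ koszul_tensorial_right hX hY) v)
        map_add' := fun v w ↦ by simp
        map_smul' := fun c v ↦ by simp }
  else 0

theorem inner_leviCivitaAux (hX : MDiffAt (T% X) x) (hY : MDiffAt (T% Y) x)
    (hZ : MDiffAt (T% Z) x) :
    inner ℝ (leviCivitaAux Y x (X x)) (Z x) = koszul X Y Z x := by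
  simp only [leviCivitaAux, hY, dif_pos]
  simp only [LinearMap.coe_toContinuousLinearMap', LinearMap.coe_mk, AddHom.coe_mk]
  rw [InnerProductSpace.toDual_symm_apply, TensorialAt.mkHom₂_apply _ _ hX hZ]

variable (I M) in
/-- The Levi-Civita connection of the Riemannian metric on `M`, built from the Koszul formula.
In Mathlib's argument order `leviCivita I M Y x v` is `(∇_v Y)(x)`. -/
def leviCivita : CovariantDerivative I E (fun x : M ↦ TangentSpace I x) where
  toFun := leviCivitaAux
  isCovariantDerivativeOnUniv :=
    { add := fun {Y Y' x} hY hY' _ ↦ by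
        ext1 v
        refine ext_inner_right ℝ fun w ↦ ?_
        have hv := mdifferentiableAt_extend I E v
        have hw := mdifferentiableAt_extend I E w
        have h1 := inner_leviCivitaAux hv hY hw
        have h2 := inner_leviCivitaAux hv hY' hw
        have h3 := inner_leviCivitaAux hv (mdifferentiableAt_add_section hY hY') hw
        have h4 := koszul_add_middle hv hY hY' hw
        simp only [extend_apply_self] at h1 h2 h3
        simp only [add_apply, inner_add_left, h1, h2, ← h4]
        exact h3
      leibniz := fun {Y f x} hY hf _ ↦ by
        ext1 v
        refine ext_inner_right ℝ fun w ↦ ?_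
        have hv := mdifferentiableAt_extend I E v
        have hw := mdifferentiableAt_extend I E w
        have h1 := inner_leviCivitaAux hv hY hw
        have h3 := inner_leviCivitaAux hv (hf.smul_section hY) hw
        have h4 := koszul_smul_middle hf hv hY hw
        simp only [extend_apply_self] at h1 h3 h4
        simp only [add_apply, inner_add_left, smul_apply,
          inner_smul_left, h1, ContinuousLinearMap.smulRight_apply]
        refine (h3.trans h4).trans ?_
        simp }

/-- The Levi-Civita connection is torsion-free. -/
theorem leviCivita_torsion : (leviCivita I M).torsion = 0 := by
  have : CompleteSpace E := FiniteDimensional.complete ℝ E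
  rw [CovariantDerivative.torsion_eq_zero_iff]
  intro X Y x hX hY
  refine ext_inner_right ℝ fun w ↦ ?_
  have hw := mdifferentiableAt_extend I E w
  have h1 := inner_leviCivitaAux hX hY hw
  have h2 := inner_leviCivitaAux hY hX hw
  simp only [extend_apply_self] at h1 h2
  rw [inner_sub_left]
  refine (congrArg₂ (· - ·) h1 h2).trans ?_
  simp only [koszul, extend_apply_self, mlieBracket_swap_apply (V := extend E w),
    mlieBracket_swap_apply (V := Y) (W := X), inner_neg_left,
    real_inner_comm (X _) (extend E w _),  real_inner_comm (Y _) (extend E w _),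
    real_inner_comm (X _) (Y _)]
  ring

/-- The Levi-Civita connection is compatible with the metric. -/
theorem leviCivita_metric (hX : MDiffAt (T% X) x) (hY : MDiffAt (T% Y) x)
    (hZ : MDiffAt (T% Z) x) :
    mvfderiv I (fun y ↦ inner ℝ (Y y) (Z y)) x (X x)
      = inner ℝ (leviCivita I M Y x (X x)) (Z x) + inner ℝ (Y x) (leviCivita I M Z x (X x)) := by
  have h1 := inner_leviCivitaAux hX hY hZ
  have h2 := inner_leviCivitaAux hX hZ hY
  rw [real_inner_comm] at h2
  refine Eq.trans ?_ (congrArg₂ (· + ·) h1 h2).symm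
  simp only [koszul, mlieBracket_swap_apply (V := Z) (W := Y),
    mlieBracket_swap_apply (V := X) (W := Z),
    mlieBracket_swap_apply (V := Y) (W := X), inner_neg_left,
    real_inner_comm (Y _) (Z _), real_inner_comm (X _) (Y _),
    real_inner_comm (Z _) (X _)]
  ring

/-- The curvature `R(X, Y)Z = ∇_X ∇_Y Z - ∇_Y ∇_X Z - ∇_[X,Y] Z`. -/
def curvature (X Y Z : Π x : M, TangentSpace I x) (x : M) : TangentSpace I x :=
  leviCivita I M (fun y ↦ leviCivita I M Z y (Y y)) x (X x)
    - leviCivita I M (fun y ↦ leviCivita I M Z y (X y)) x (Y x)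
    - leviCivita I M Z x (mlieBracket I X Y x)

/-- The sectional curvature `K(u ∧ v) = g(R(u, v)v, u) / (|u|²|v|² - g(u, v)²)` of the plane spanned
by two tangent vectors at `x`; the vectors are extended to fields that are smooth near `x`, and the
value does not depend on the extensions. -/
def sectionalCurvature (x : M) (u v : TangentSpace I x) : ℝ :=
  inner ℝ (curvature (extend E u) (extend E v) (extend E v) x) u
    / (‖u‖ ^ 2 * ‖v‖ ^ 2 - inner ℝ u v ^ 2)

/-! ### Distributions and their extrinsic geometry -/

variable (I M) in
/-- A field of tangent subspaces. Smoothness and rank are stated separately. -/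
abbrev Distribution : Type _ := Π x : M, Submodule ℝ (TangentSpace I x)

namespace Distribution

variable (D : Distribution I M)

/-- The fields `e i` form a smooth frame of `D` on `U`. -/
structure IsFrameOn {k : ℕ} (e : Fin k → Π x : M, TangentSpace I x) (U : Set M) : Prop where
  smooth : ∀ i, CMDiff[U] ∞ (T% (e i))
  linearIndependent : ∀ x ∈ U, LinearIndependent ℝ (fun i ↦ e i x)
  span_eq : ∀ x ∈ U, Submodule.span ℝ (Set.range fun i ↦ e i x) = D x

/-- `D` is a smooth distribution of dimension `k`: it has smooth local frames with `k` members. -/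
def IsSmoothOfDim (k : ℕ) : Prop :=
  ∀ x : M, ∃ (U : Set M) (e : Fin k → Π y : M, TangentSpace I y),
    IsOpen U ∧ x ∈ U ∧ D.IsFrameOn e U

/-- `D` is integrable: it is tangent to a foliation, i.e. locally it is the field of kernels of the
differential of a smooth submersion onto an open subset of some `ℝ^q` (the leaves are locally the
fibres of the submersion). -/
def IsIntegrable : Prop :=
  ∀ x : M, ∃ (U : Set M) (q : ℕ) (f : M → EuclideanSpace ℝ (Fin q)),
    IsOpen U ∧ x ∈ U ∧ CMDiff[U] ∞ f ∧
      ∀ y ∈ U, Function.Surjective (mvfderiv I f y) ∧ ∀ v, v ∈ D y ↔ mvfderiv I f y v = 0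

/-- The orthogonal complementary distribution. -/
def orthogonal : Distribution I M := fun x ↦ (D x)ᗮ

/-- The second fundamental form `B^D(X, Y) = ½ (∇_X Y + ∇_Y X)^⊥`, for sections `X, Y` of `D`. -/
def secondFundamentalForm (X Y : Π x : M, TangentSpace I x) (x : M) : TangentSpace I x :=
  (D.orthogonal x).starProjection
    ((1 / 2 : ℝ) • (leviCivita I M Y x (X x) + leviCivita I M X x (Y x)))

/-- The integrability tensor `I^D(X, Y) = [X, Y]^⊥`, for sections `X, Y` of `D`. -/
def integrabilityTensor (X Y : Π x : M, TangentSpace I x) (x : M) : TangentSpace I x :=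
  (D.orthogonal x).starProjection (mlieBracket I X Y x)

/-- An orthonormal basis of `D x`. -/
def basisAt (x : M) (i : Fin (finrank ℝ (D x))) : TangentSpace I x :=
  (stdOrthonormalBasis ℝ (D x) i : D x)

/-- A section of `D` with value `D.basisAt x i` at `x` (and smooth near `x` if `D` is smooth): the
orthogonal projection to `D` of a local extension of that vector. Both `B^D` and `I^D` are
tensorial, so their values at `x` on such sections are their values on the basis vectors. -/
def sectionAt (x : M) (i : Fin (finrank ℝ (D x))) (y : M) : TangentSpace I y :=
  (D y).starProjection (extend E (D.basisAt x i) y)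

/-- The squared Hilbert-Schmidt norm `|B^D|² = ∑ i j, |B^D(e_i, e_j)|²`. -/
def normSqSecondFundamentalForm (x : M) : ℝ :=
  ∑ i, ∑ j, ‖D.secondFundamentalForm (D.sectionAt x i) (D.sectionAt x j) x‖ ^ 2

/-- The squared Hilbert-Schmidt norm `|I^D|² = ∑ i j, |I^D(e_i, e_j)|²`. -/
def normSqIntegrabilityTensor (x : M) : ℝ :=
  ∑ i, ∑ j, ‖D.integrabilityTensor (D.sectionAt x i) (D.sectionAt x j) x‖ ^ 2

/-- The vector field `trace B^D = ∑ i, B^D(e_i, e_i)`. -/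
def traceSecondFundamentalForm (x : M) : TangentSpace I x :=
  ∑ i, D.secondFundamentalForm (D.sectionAt x i) (D.sectionAt x i) x

/-- The divergence along `D`: `div^D W = ∑ i, g(∇_{e_i} W, e_i)`, with `e_i` an orthonormal basis
of `D`. -/
def divergenceAlong (W : Π x : M, TangentSpace I x) (x : M) : ℝ :=
  ∑ i, inner ℝ (leviCivita I M W x (D.basisAt x i)) (D.basisAt x i)

/-- The mixed curvature `s_mix = ∑ i α, K(e_i ∧ f_α)`, where `e_i` and `f_α` are orthonormal bases
of `D` and of its orthogonal complement. -/
def mixedCurvature (x : M) : ℝ :=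
  ∑ i, ∑ a, sectionalCurvature x (D.basisAt x i) (D.orthogonal.basisAt x a)

end Distribution

/-! ### Sasakian structures -/

/-- The value `dη(X, Y) = ½ (X η(Y) - Y η(X) - η([X, Y]))` of the exterior derivative of a
`1`-form (with the factor `½` in its definition). -/
def extDerivOneForm (η : Π x : M, TangentSpace I x →L[ℝ] ℝ) (X Y : Π x : M, TangentSpace I x)
    (x : M) : ℝ :=
  (mvfderiv I (fun y ↦ η y (Y y)) x (X x) - mvfderiv I (fun y ↦ η y (X y)) x (Y x)
    - η x (mlieBracket I X Y x)) / 2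

/-- The value of `η ∧ (dη)^n` on `2n + 1` tangent vectors at `x`, up to a positive constant that
depends only on `n` and on the convention for the wedge product. -/
def contactVolume (n : ℕ) (η : Π x : M, TangentSpace I x →L[ℝ] ℝ) (x : M)
    (v : Fin (2 * n + 1) → TangentSpace I x) : ℝ :=
  ∑ σ : Equiv.Perm (Fin (2 * n + 1)), ((Equiv.Perm.sign σ : ℤ) : ℝ) *
    (η x (v (σ 0)) * ∏ i : Fin n,
      extDerivOneForm η (extend E (v (σ ⟨2 * i + 1, by omega⟩)))
        (extend E (v (σ ⟨2 * i + 2, by omega⟩))) x)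

variable (I M) in
/-- An almost contact metric structure `(φ, ξ, η, g)` on a Riemannian manifold `(M, g)`. -/
structure AlmostContactMetricStructure where
  /-- the `(1, 1)`-tensor field -/
  φ : Π x : M, TangentSpace I x →L[ℝ] TangentSpace I x
  /-- the characteristic vector field -/
  ξ : Π x : M, TangentSpace I x
  /-- the `1`-form -/
  η : Π x : M, TangentSpace I x →L[ℝ] ℝ
  smooth_φ : ContMDiff I (I.prod 𝓘(ℝ, E →L[ℝ] E)) ∞ (fun x ↦ (TotalSpace.mk' (E →L[ℝ] E) x (φ x) :
    TotalSpace (E →L[ℝ] E) (fun x : M ↦ TangentSpace I x →L[ℝ] TangentSpace I x)))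
  smooth_ξ : CMDiff ∞ (T% ξ)
  smooth_η : ContMDiff I (I.prod 𝓘(ℝ, E →L[ℝ] ℝ)) ∞ (fun x ↦ (TotalSpace.mk' (E →L[ℝ] ℝ) x (η x) :
    TotalSpace (E →L[ℝ] ℝ) (fun x : M ↦ TangentSpace I x →L[ℝ] Bundle.Trivial M ℝ x)))
  φ_φ : ∀ x v, φ x (φ x v) = -v + η x v • ξ x
  η_ξ : ∀ x, η x (ξ x) = 1
  inner_φ_φ : ∀ x v w, inner ℝ (φ x v) (φ x w) = inner ℝ v w - η x v * η x w

namespace AlmostContactMetricStructure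

variable (S : AlmostContactMetricStructure I M)

/-- The vector field `φX`. -/
def applyφ (X : Π x : M, TangentSpace I x) : Π x : M, TangentSpace I x := fun x ↦ S.φ x (X x)

/-- `η` is a contact form and `g` is an associated metric; here `dim M = 2n + 1`. -/
structure IsContactMetric (n : ℕ) : Prop where
  isContactForm : ∀ x : M, ∃ v, contactVolume n S.η x v ≠ 0
  associated : ∀ (x : M) (X Y : Π y : M, TangentSpace I y),
    CMDiffAt ∞ (T% X) x → CMDiffAt ∞ (T% Y) x →
      extDerivOneForm S.η X Y x = inner ℝ (X x) (S.φ x (Y x))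

/-- The Nijenhuis torsion `[φ, φ](X, Y) = φ²[X, Y] + [φX, φY] - φ[φX, Y] - φ[X, φY]`. -/
def nijenhuis (X Y : Π x : M, TangentSpace I x) (x : M) : TangentSpace I x :=
  S.φ x (S.φ x (mlieBracket I X Y x)) + mlieBracket I (S.applyφ X) (S.applyφ Y) x
    - S.φ x (mlieBracket I (S.applyφ X) Y x) - S.φ x (mlieBracket I X (S.applyφ Y) x)

/-- The structure is normal: `[φ, φ](X, Y) + 2 dη(X, Y) ξ = 0`. -/
def IsNormal : Prop :=
  ∀ (x : M) (X Y : Π y : M, TangentSpace I y), CMDiffAt ∞ (T% X) x → CMDiffAt ∞ (T% Y) x →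
    S.nijenhuis X Y x + (2 * extDerivOneForm S.η X Y x) • S.ξ x = 0

/-- A Sasakian structure is a normal contact metric structure; here `dim M = 2n + 1`. -/
structure IsSasakian (n : ℕ) : Prop where
  isContactMetric : S.IsContactMetric n
  isNormal : S.IsNormal

/-- The local vector field `X` on `U` is contact-holomorphic: it is smooth and
`(L_X φ)Y = η([X, φY]) ξ` for all `Y`, where `(L_X φ)Y = [X, φY] - φ[X, Y]`. -/
structure IsContactHolomorphicOn (X : Π x : M, TangentSpace I x) (U : Set M) : Prop where
  smooth : CMDiff[U] ∞ (T% X)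
  lie_φ : ∀ x ∈ U, ∀ Y : Π y : M, TangentSpace I y, CMDiffAt ∞ (T% Y) x →
    mlieBracket I X (S.applyφ Y) x - S.φ x (mlieBracket I X Y x)
      = S.η x (mlieBracket I X (S.applyφ Y) x) • S.ξ x

/-- The distribution `V` of dimension `k` is contact-holomorphic: around every point it has a local
frame of contact-holomorphic vector fields. -/
def IsContactHolomorphic (V : Distribution I M) (k : ℕ) : Prop :=
  ∀ x : M, ∃ (U : Set M) (e : Fin k → Π y : M, TangentSpace I y),
    IsOpen U ∧ x ∈ U ∧ V.IsFrameOn e U ∧ ∀ i, S.IsContactHolomorphicOn (e i) U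

/-- The distribution `V` is invariant: `φ(V) ⊆ V`. -/
def IsInvariant (V : Distribution I M) : Prop := ∀ x : M, ∀ v ∈ V x, S.φ x v ∈ V x

end AlmostContactMetricStructure

end

end SasakiWalczak

open Bundle FiberBundle VectorField Module
open scoped Manifold ContDiff Topology

namespace SasakiWalczak

noncomputable section

set_option linter.unusedSectionVars false

variable {E : Type*} [NormedAddCommGroup E] [NormedSpace ℝ E] [FiniteDimensional ℝ E]
  {H : Type*} [TopologicalSpace H] {I : ModelWithCorners ℝ E H}
  {M : Type*} [TopologicalSpace M] [ChartedSpace H M] [IsManifold I ∞ M]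
  [RiemannianBundle (fun x : M ↦ TangentSpace I x)]
  [IsContMDiffRiemannianBundle I ∞ E (fun x : M ↦ TangentSpace I x)]

/-! For a distribution D put h(u, v) = (∇_u Y)^⊥, where Y is any section of D through v
(`secondForm`). The vector u is arbitrary, not only tangent to D. This tensor is minus the adjoint
of the corresponding tensor of D^⊥, because differentiating g(Y, Z) = 0 moves ∇_u from one factor to
the other. On D its symmetric part is B^D and its skew part is ½ I^D, so Q(D) = ∑ g(h(e_i, e_j),
h(e_j, e_i)) equals |B^D|² - ¼|I^D|².

The general ingredient is Walczak's formula (`IsRegular.mixedCurvature_eq`): s_mix = div^D tr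
B^{D^⊥} + div^{D^⊥} tr B^D - Q(D) - Q(D^⊥). It comes from expanding g(R(X, Y)Y, X) in orthonormal
frames adapted to D and D^⊥. The connection coefficients inside D and inside D^⊥ are skew in the
frame indices and multiply symmetric expressions, so they drop out of the sum.

It remains to see that tr B^V = 0 and Q(H) = -dim H = -2(n - p). Odd rank forces ξ ∈ V. The Sasakian
identities ∇_u ξ = -φu and (∇_u φ)v = g(u, v)ξ - η(v)u give h(u, φv) = φ h(u, v) - η(v) u^H for v in
V, and the contact-holomorphic frame gives h(φu, v) = φ h(u, v) (`secondForm_φ_right`,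
`secondForm_φ_left`). Moreover, for every bilinear B the sum of B(φe_i, φe_i) over V is the trace of
B minus B(ξ, ξ) (`IsInvariant.sum_apply_φ_φ`). With B = h, where h(φv, φv) = -h(v, v) on V and h(ξ,
ξ) = 0, this yields tr B^V = 0. With B(v, w) = h(h(u, v), w) for u in H it yields ∑ h(h(u, e_i),
e_i) = -u, and by the duality between h and the tensor of H the trace of this identity over H is
Q(H) = -dim H. If V is integrable, I^V = 0 as well. -/

/-! ### Differentiation of functions and vector fields -/

theorem eventually_mdifferentiableAt {X : Π x : M, TangentSpace I x} {x : M}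
    (hX : CMDiffAt ∞ (T% X) x) : ∀ᶠ y in 𝓝 x, MDiffAt (T% X) y := by
  have h1 : CMDiffAt 1 (T% X) x := hX.of_le (by norm_cast)
  have : IsManifold I 1 M := IsManifold.of_le (n := ∞) (by norm_cast)
  filter_upwards [(contMDiffAt_iff_contMDiffAt_nhds (by simp)).1 h1] with y hy
  exact hy.mdifferentiableAt one_ne_zero

theorem eventually_mdifferentiableAt_fun {f : M → ℝ} {x : M}
    (hf : CMDiffAt ∞ f x) : ∀ᶠ y in 𝓝 x, MDiffAt f y := by
  have h1 : CMDiffAt 1 f x := hf.of_le (by norm_cast)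
  have : IsManifold I 1 M := IsManifold.of_le (n := ∞) (by norm_cast)
  filter_upwards [(contMDiffAt_iff_contMDiffAt_nhds (by simp)).1 h1] with y hy
  exact hy.mdifferentiableAt one_ne_zero

theorem mdifferentiableAt_of_contMDiffAt {X : Π x : M, TangentSpace I x} {x : M}
    (hX : CMDiffAt ∞ (T% X) x) : MDiffAt (T% X) x := hX.mdifferentiableAt (by simp)

theorem contMDiffAt_inner {X Y : Π x : M, TangentSpace I x} {x : M}
    (hX : CMDiffAt ∞ (T% X) x) (hY : CMDiffAt ∞ (T% Y) x) :
    CMDiffAt ∞ (fun y ↦ inner ℝ (X y) (Y y)) x :=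
  ContMDiffAt.inner_bundle (F := E) (E := fun x : M ↦ TangentSpace I x) hX hY

theorem contMDiffAt_mlieBracket {X Y : Π x : M, TangentSpace I x} {x : M}
    (hX : CMDiffAt ∞ (T% X) x) (hY : CMDiffAt ∞ (T% Y) x) :
    CMDiffAt ∞ (T% (mlieBracket I X Y)) x := by
  have : CompleteSpace E := FiniteDimensional.complete ℝ E
  have : IsManifold I (minSmoothness ℝ 2) M :=
    IsManifold.of_le (n := ∞) (by simp; norm_cast)
  have : IsManifold I (((⊤ : ℕ∞) : WithTop ℕ∞) + 1) M := by
    simpa using (inferInstance : IsManifold I ∞ M)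
  exact ContMDiffAt.mlieBracket_vectorField (m := ⊤) (n := ⊤) hX hY (by simp)

theorem mvfderiv_congr {f g : M → ℝ} {x : M} (h : f =ᶠ[𝓝 x] g) :
    mvfderiv I f x = mvfderiv I g x := by
  simp only [mvfderiv]
  rw [h.mfderiv_eq]
  have := h.eq_of_nhds
  congr 1

theorem mvfderiv_eq_zero_of_eventually_const {f : M → ℝ} {x : M} {c : ℝ}
    (h : ∀ᶠ y in 𝓝 x, f y = c) : mvfderiv I f x = 0 := by
  rw [mvfderiv_congr (g := fun _ ↦ c) h, mvfderiv_const]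

theorem leviCivita_congr {Y Y' : Π x : M, TangentSpace I x} {x : M}
    (hY : MDiffAt (T% Y) x) (hY' : MDiffAt (T% Y') x) (h : ∀ᶠ y in 𝓝 x, Y y = Y' y) :
    leviCivita I M Y x = leviCivita I M Y' x :=
  (leviCivita I M).isCovariantDerivativeOnUniv.congr_of_eventuallyEq hY hY' Filter.univ_mem h

theorem leviCivita_sub_leviCivita {X Y : Π x : M, TangentSpace I x} {x : M}
    (hX : MDiffAt (T% X) x) (hY : MDiffAt (T% Y) x) :
    leviCivita I M Y x (X x) - leviCivita I M X x (Y x) = mlieBracket I X Y x := by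
  have : CompleteSpace E := FiniteDimensional.complete ℝ E
  exact (leviCivita I M).torsion_eq_zero_iff.1 leviCivita_torsion hX hY

theorem mvfderiv_inner {Y Z : Π x : M, TangentSpace I x} {x : M} (v : TangentSpace I x)
    (hY : MDiffAt (T% Y) x) (hZ : MDiffAt (T% Z) x) :
    mvfderiv I (fun y ↦ inner ℝ (Y y) (Z y)) x v
      = inner ℝ (leviCivita I M Y x v) (Z x) + inner ℝ (Y x) (leviCivita I M Z x v) := by
  have := leviCivita_metric (mdifferentiableAt_extend I E v) hY hZ
  simpa using this

/-- The Leibniz rule [X, fZ] = (Xf)Z + f[X, Z] recovers Xf as g([X, fZ] - f[X, Z], Z) / g(Z, Z) for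
a field Z with Z x ≠ 0, so smoothness of brackets suffices. Dimension zero, where no such Z exists,
is separate. -/
theorem contMDiffAt_mvfderiv_apply {f : M → ℝ} {X : Π x : M, TangentSpace I x} {x : M}
    (hf : CMDiffAt ∞ f x) (hX : CMDiffAt ∞ (T% X) x) :
    CMDiffAt ∞ (fun y ↦ mvfderiv I f y (X y)) x := by
  have : CompleteSpace E := FiniteDimensional.complete ℝ E
  rcases subsingleton_or_nontrivial E with hE | hE
  · have : (fun y ↦ mvfderiv I f y (X y)) = fun _ ↦ 0 := by
      funext y
      have : X y = 0 := hE.elim (α := E) _ _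
      rw [this, map_zero]
    rw [this]
    exact contMDiffAt_const
  obtain ⟨v, hv⟩ := exists_ne (0 : E)
  let Z : Π x : M, TangentSpace I x := extend E (x := x) (v : TangentSpace I x)
  have hZ : CMDiffAt ∞ (T% Z) x := contMDiffAt_extend I E _
  have hZZ := contMDiffAt_inner hZ hZ
  have hZx : inner ℝ (Z x) (Z x) ≠ 0 := by
    have : Z x = v := extend_apply_self _ _
    rw [this]
    exact inner_self_ne_zero.2 hv
  have h1 : CMDiffAt ∞ (T% (f • Z)) x := hf.smul_section hZ
  have h2 := contMDiffAt_mlieBracket hX h1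
  have h3 := (hf.smul_section (contMDiffAt_mlieBracket hX hZ))
  have h4 := (contMDiffAt_inner (h2.sub_section h3) hZ).div₀ hZZ hZx
  refine h4.congr_of_eventuallyEq ?_
  have hne : ∀ᶠ y in 𝓝 x, inner ℝ (Z y) (Z y) ≠ 0 := hZZ.continuousAt.eventually_ne hZx
  filter_upwards [eventually_mdifferentiableAt_fun hf, eventually_mdifferentiableAt hZ, hne]
    with y hfy hZy hney
  simp [mlieBracket_smul_right hfy hZy, inner_smul_left] at hney ⊢
  field_simp

/-- The derivative along a Lie bracket is the commutator of the derivatives. -/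
theorem mvfderiv_mlieBracket {f : M → ℝ} {X Y : Π x : M, TangentSpace I x} {x : M}
    (hf : CMDiffAt ∞ f x) (hX : CMDiffAt ∞ (T% X) x) (hY : CMDiffAt ∞ (T% Y) x) :
    mvfderiv I f x (mlieBracket I X Y x)
      = mvfderiv I (fun y ↦ mvfderiv I f y (Y y)) x (X x)
        - mvfderiv I (fun y ↦ mvfderiv I f y (X y)) x (Y x) := by
  have : CompleteSpace E := FiniteDimensional.complete ℝ E
  rcases subsingleton_or_nontrivial E with hE | hE
  · have h (v : TangentSpace I x) : v = 0 := hE.elim (α := E) _ _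
    simp [h (mlieBracket I X Y x), h (X x), h (Y x)]
  obtain ⟨v, hv⟩ := exists_ne (0 : E)
  let Z : Π x : M, TangentSpace I x := extend E (x := x) (v : TangentSpace I x)
  have hZ : CMDiffAt ∞ (T% Z) x := contMDiffAt_extend I E _
  have hfd : MDiffAt f x := hf.mdifferentiableAt (by simp)
  -- Compare the Jacobi identity for X, Y, fZ with the one for X, Y, Z. Every first-order term
  -- cancels, and what is left is the claimed identity multiplied by Z, which is nonzero at x.
  have key {A : Π x : M, TangentSpace I x} (B : Π x : M, TangentSpace I x)
      (hA : CMDiffAt ∞ (T% A) x) :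
      mlieBracket I B (mlieBracket I A (f • Z)) x
        = mvfderiv I (fun y ↦ mvfderiv I f y (A y)) x (B x) • Z x
          + mvfderiv I f x (A x) • mlieBracket I B Z x
          + mvfderiv I f x (B x) • mlieBracket I A Z x
          + f x • mlieBracket I B (mlieBracket I A Z) x := by
    have hAf := (contMDiffAt_mvfderiv_apply hf hA)
    have hAfd := hAf.mdifferentiableAt (n := ∞) (by simp)
    have hAZ := contMDiffAt_mlieBracket hA hZ
    have e : mlieBracket I A (f • Z)
        =ᶠ[𝓝 x] ((fun y ↦ mvfderiv I f y (A y)) • Z + f • mlieBracket I A Z) := by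
      filter_upwards [eventually_mdifferentiableAt_fun hf, eventually_mdifferentiableAt hZ]
        with y hfy hZy
      rw [mlieBracket_smul_right hfy hZy]
      rfl
    rw [Filter.EventuallyEq.mlieBracket_vectorField_eq (Filter.EventuallyEq.refl _ B) e,
      mlieBracket_add_right (mdifferentiableAt_of_contMDiffAt (hAf.smul_section hZ))
        (mdifferentiableAt_of_contMDiffAt (hf.smul_section hAZ)),
      mlieBracket_smul_right hAfd (mdifferentiableAt_of_contMDiffAt hZ),
      mlieBracket_smul_right hfd (mdifferentiableAt_of_contMDiffAt hAZ)]
    abel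
  have h2 : minSmoothness ℝ 2 ≤ ∞ := by simp; norm_cast
  have : IsManifold I (minSmoothness ℝ 3) M :=
    IsManifold.of_le (n := ∞) (by simp; norm_cast)
  have hfZ : CMDiffAt ∞ (T% (f • Z)) x := hf.smul_section hZ
  have J1 := leibniz_identity_mlieBracket_apply (hX.of_le h2) (hY.of_le h2) (hfZ.of_le h2)
  have J2 := leibniz_identity_mlieBracket_apply (hX.of_le h2) (hY.of_le h2) (hZ.of_le h2)
  rw [key X hY, key Y hX, mlieBracket_smul_right hfd (mdifferentiableAt_of_contMDiffAt hZ), J2] at J1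
  have hZx : Z x ≠ 0 := by
    have : Z x = v := extend_apply_self _ _
    rw [this]
    exact hv
  have h0 : (mvfderiv I f x (mlieBracket I X Y x)
      - (mvfderiv I (fun y ↦ mvfderiv I f y (Y y)) x (X x)
        - mvfderiv I (fun y ↦ mvfderiv I f y (X y)) x (Y x))) • Z x = 0 := by
    simp only [sub_smul]
    simp only [smul_add] at J1
    rw [← sub_eq_zero] at J1 
    rw [← neg_eq_zero, ← J1]
    abel
  exact sub_eq_zero.1 ((smul_eq_zero.1 h0).resolve_right hZx)

theorem contMDiffAt_of_eq {X Y : Π x : M, TangentSpace I x} {x : M} (h : X = Y)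
    (hY : CMDiffAt ∞ (T% Y) x) : CMDiffAt ∞ (T% X) x := h ▸ hY

/-! ### Smooth orthonormal frames and smoothness of ∇_X Y -/

open InnerProductSpace in
-- Induction along the Gram-Schmidt recursion. The denominators |gs_j|² are nonzero at x by
-- independence there, which is all that smoothness at x requires.
theorem contMDiffAt_gramSchmidt {k : ℕ} {e : Fin k → Π x : M, TangentSpace I x} {x : M}
    (he : ∀ i, CMDiffAt ∞ (T% (e i)) x) (hli : LinearIndependent ℝ (fun i ↦ e i x)) (i : Fin k) :
    CMDiffAt ∞ (T% (fun y ↦ gramSchmidt ℝ (fun j ↦ e j y) i)) x := by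
  induction i using WellFoundedLT.induction with
  | ind i ih =>
    let gs (j : Fin k) : Π y : M, TangentSpace I y := fun y ↦ gramSchmidt ℝ (fun j ↦ e j y) j
    have h : (fun y ↦ gramSchmidt ℝ (fun j ↦ e j y) i)
        = e i - fun y ↦ ∑ j ∈ Finset.Iio i,
          ((fun y ↦ (inner ℝ (gs j y) (e i y) / inner ℝ (gs j y) (gs j y) : ℝ)) • gs j) y := by
      funext y
      have := gramSchmidt_def'' ℝ (fun j ↦ e j y) i
      rw [← sub_eq_iff_eq_add] at this
      rw [← this]
      simp [gs]
    refine contMDiffAt_of_eq h ((he i).sub_section (ContMDiffAt.sum_section fun j hj ↦ ?_))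
    have hj' := ih j (Finset.mem_Iio.1 hj)
    refine ContMDiffAt.smul_section ?_ hj'
    exact (contMDiffAt_inner hj' (he i)).div₀ (contMDiffAt_inner hj' hj')
      (inner_self_ne_zero.2 (gramSchmidt_ne_zero j hli))

open InnerProductSpace in
theorem contMDiffAt_gramSchmidtNormed {k : ℕ} {e : Fin k → Π x : M, TangentSpace I x} {x : M}
    (he : ∀ i, CMDiffAt ∞ (T% (e i)) x) (hli : LinearIndependent ℝ (fun i ↦ e i x)) (i : Fin k) :
    CMDiffAt ∞ (T% (fun y ↦ gramSchmidtNormed ℝ (fun j ↦ e j y) i)) x := by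
  have h := contMDiffAt_gramSchmidt he hli i
  have h0 : inner ℝ (gramSchmidt ℝ (fun j ↦ e j x) i) (gramSchmidt ℝ (fun j ↦ e j x) i) ≠ 0 :=
    inner_self_ne_zero.2 (gramSchmidt_ne_zero i hli)
  have hs : CMDiffAt ∞ (fun y ↦ √(inner ℝ (gramSchmidt ℝ (fun j ↦ e j y) i)
      (gramSchmidt ℝ (fun j ↦ e j y) i))) x :=
    (Real.contDiffAt_sqrt h0).contMDiffAt.comp x (contMDiffAt_inner h h)
  have hs' := hs.inv₀ (by
    rw [← norm_eq_sqrt_real_inner]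
    exact norm_ne_zero_iff.2 (gramSchmidt_ne_zero i hli))
  refine (hs'.smul_section h).congr_of_eventuallyEq (Filter.Eventually.of_forall fun y ↦ ?_)
  simp [gramSchmidtNormed]

open InnerProductSpace in
-- Orthogonality always holds. Unit length only needs the unnormalized vectors to be nonzero, an
-- open condition that holds at x.
theorem eventually_orthonormal_gramSchmidtNormed {k : ℕ}
    {e : Fin k → Π x : M, TangentSpace I x} {x : M}
    (he : ∀ i, CMDiffAt ∞ (T% (e i)) x) (hli : LinearIndependent ℝ (fun i ↦ e i x)) :
    ∀ᶠ y in 𝓝 x, Orthonormal ℝ (gramSchmidtNormed ℝ (fun j ↦ e j y)) := by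
  have h (i : Fin k) : ∀ᶠ y in 𝓝 x, inner ℝ (gramSchmidt ℝ (fun j ↦ e j y) i)
      (gramSchmidt ℝ (fun j ↦ e j y) i) ≠ 0 :=
    (contMDiffAt_inner (contMDiffAt_gramSchmidt he hli i)
      (contMDiffAt_gramSchmidt he hli i)).continuousAt.eventually_ne
        (inner_self_ne_zero.2 (gramSchmidt_ne_zero i hli))
  filter_upwards [Filter.eventually_all.2 h] with y hy
  refine ⟨fun i ↦ gramSchmidtNormed_unit_length' ?_, fun i j hij ↦ ?_⟩
  · have := inner_self_ne_zero.1 (hy i)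
    simpa [gramSchmidtNormed] using this
  · simp [gramSchmidtNormed, inner_smul_left, inner_smul_right, gramSchmidt_orthogonal ℝ _ hij]

open InnerProductSpace in
theorem gramSchmidtNormed_mem {k : ℕ} {F : Type*} [NormedAddCommGroup F] [InnerProductSpace ℝ F]
    {K : Submodule ℝ F} {f : Fin k → F} (hf : ∀ i, f i ∈ K) (i : Fin k) :
    gramSchmidtNormed ℝ f i ∈ K := by
  refine K.smul_mem _ ?_
  have h : gramSchmidt ℝ f i ∈ Submodule.span ℝ (Set.range f) := by
    rw [← span_gramSchmidt ℝ f]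
    exact Submodule.subset_span ⟨i, rfl⟩
  exact Submodule.span_le.2 (Set.range_subset_iff.2 hf) h

open InnerProductSpace in
theorem gramSchmidtNormed_of_orthonormal {k : ℕ} {F : Type*} [NormedAddCommGroup F]
    [InnerProductSpace ℝ F] {f : Fin k → F} (hf : Orthonormal ℝ f) (i : Fin k) :
    gramSchmidtNormed ℝ f i = f i := by
  simp [gramSchmidtNormed, gramSchmidt_of_orthogonal ℝ (f := f) (fun _ _ h ↦ hf.2 h), hf.1 i]

theorem sum_inner_smul_eq_starProjection {k : ℕ} {F : Type*} [NormedAddCommGroup F]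
    [InnerProductSpace ℝ F] {K : Submodule ℝ F} [FiniteDimensional ℝ K] {f : Fin k → F}
    (hf : Orthonormal ℝ f) (hK : ∀ i, f i ∈ K) (hk : finrank ℝ K = k) (v : F) :
    ∑ i, inner ℝ (f i) v • f i = K.starProjection v := by
  have hspan : Submodule.span ℝ (Set.range f) = K := by
    refine Submodule.eq_of_le_of_finrank_eq (Submodule.span_le.2 (Set.range_subset_iff.2 hK)) ?_
    rw [finrank_span_eq_card hf.linearIndependent, hk, Fintype.card_fin]
  symm
  refine Submodule.eq_starProjection_of_mem_orthogonal
    (Submodule.sum_mem _ fun i _ ↦ K.smul_mem _ (hK i)) ?_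
  rw [← hspan, Submodule.mem_orthogonal]
  intro u hu
  induction hu using Submodule.span_induction with
  | mem u hu =>
    obtain ⟨i, rfl⟩ := hu
    rw [inner_sub_right, hf.inner_right_fintype, sub_self]
  | zero => simp
  | add u w _ _ hu hw => rw [inner_add_left, hu, hw, add_zero]
  | smul c u _ hu => rw [inner_smul_left, hu, mul_zero]

open InnerProductSpace in
/-- A vector field is smooth at a point if its inner products with smooth fields are. -/
theorem contMDiffAt_of_inner {X : Π x : M, TangentSpace I x} {x : M}
    (h : ∀ Z : Π x : M, TangentSpace I x, CMDiffAt ∞ (T% Z) x →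
      CMDiffAt ∞ (fun y ↦ inner ℝ (Z y) (X y)) x) : CMDiffAt ∞ (T% X) x := by
  -- Extend a basis at x and orthonormalize it nearby. In this frame X is the sum of its components,
  -- which are smooth by hypothesis.
  let b := stdOrthonormalBasis ℝ (TangentSpace I x)
  let e (i : Fin (finrank ℝ (TangentSpace I x))) : Π y : M, TangentSpace I y := extend E (b i)
  have he i : CMDiffAt ∞ (T% (e i)) x := contMDiffAt_extend I E _
  have hli : LinearIndependent ℝ (fun i ↦ e i x) := by
    have : (fun i ↦ e i x) = b := by funext i; exact extend_apply_self _ _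
    rw [this]
    exact b.orthonormal.linearIndependent
  have hg := contMDiffAt_gramSchmidtNormed he hli
  have hX : CMDiffAt ∞ (T% (fun y ↦ ∑ i, ((fun y ↦ (inner ℝ (gramSchmidtNormed ℝ (fun j ↦ e j y) i)
      (X y) : ℝ)) • (fun y ↦ gramSchmidtNormed ℝ (fun j ↦ e j y) i)
        : Π y : M, TangentSpace I y) y)) x :=
    ContMDiffAt.sum_section fun i _ ↦ (h _ (hg i)).smul_section (hg i)
  refine hX.congr_of_eventuallyEq ?_
  filter_upwards [eventually_orthonormal_gramSchmidtNormed he hli] with y hy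
  have := sum_inner_smul_eq_starProjection (K := ⊤) hy (fun _ ↦ trivial)
    (by rw [finrank_top]; rfl) (X y)
  simp only [Submodule.starProjection_top, ContinuousLinearMap.id_apply] at this
  simp [this]

/-- The vector field `∇_X Y`. -/
abbrev covDeriv (X Y : Π x : M, TangentSpace I x) (x : M) : TangentSpace I x :=
  leviCivita I M Y x (X x)

/-- Against a smooth Z the pairing is the Koszul expression, made of derivatives, inner products and
brackets of smooth fields. -/
theorem contMDiffAt_covDeriv {X Y : Π x : M, TangentSpace I x} {x : M}
    (hX : CMDiffAt ∞ (T% X) x) (hY : CMDiffAt ∞ (T% Y) x) :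
    CMDiffAt ∞ (T% (covDeriv X Y)) x := by
  refine contMDiffAt_of_inner fun Z hZ ↦ ?_
  have h : CMDiffAt ∞ (koszul X Y Z) x := by
    have h1 := contMDiffAt_mvfderiv_apply (contMDiffAt_inner hY hZ) hX
    have h2 := contMDiffAt_mvfderiv_apply (contMDiffAt_inner hZ hX) hY
    have h3 := contMDiffAt_mvfderiv_apply (contMDiffAt_inner hX hY) hZ
    have h4 := contMDiffAt_inner (contMDiffAt_mlieBracket hX hY) hZ
    have h5 := contMDiffAt_inner (contMDiffAt_mlieBracket hY hZ) hX
    have h6 := contMDiffAt_inner (contMDiffAt_mlieBracket hZ hX) hY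
    exact (((((h1.add h2).sub h3).add h4).sub h5).add h6).div_const _
  refine h.congr_of_eventuallyEq ?_
  filter_upwards [eventually_mdifferentiableAt hX, eventually_mdifferentiableAt hY,
    eventually_mdifferentiableAt hZ] with y hXy hYy hZy
  rw [real_inner_comm]
  exact inner_leviCivitaAux hXy hYy hZy

/-! ### Regular distributions and adapted frames -/

namespace Distribution

/-- The orthogonal projection to `D` preserves smoothness, and the rank of `D` is constant. -/
structure IsRegular (D : Distribution I M) : Prop where
  contMDiffAt_starProjection : ∀ {x : M} {X : Π x : M, TangentSpace I x}, CMDiffAt ∞ (T% X) x →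
    CMDiffAt ∞ (T% (fun y ↦ (D y).starProjection (X y))) x
  finrank_eq : ∀ x y, finrank ℝ (D x) = finrank ℝ (D y)

variable {D : Distribution I M}

theorem IsRegular.orthogonal (hD : D.IsRegular) : D.orthogonal.IsRegular where
  contMDiffAt_starProjection {x X} hX := by
    have h : (fun y ↦ (D.orthogonal y).starProjection (X y))
        = X - fun y ↦ (D y).starProjection (X y) := by
      funext y
      simp [Distribution.orthogonal, Submodule.starProjection_orthogonal]
    exact contMDiffAt_of_eq h <| hX.sub_section (hD.contMDiffAt_starProjection hX)
  finrank_eq x y := by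
    have hx := (D x).finrank_add_finrank_orthogonal
    have hy := (D y).finrank_add_finrank_orthogonal
    have h1 := hD.finrank_eq x y
    have h2 : finrank ℝ (TangentSpace I x) = finrank ℝ (TangentSpace I y) := rfl
    exact Nat.add_left_cancel (hx.trans (h2.trans (hy.symm.trans (by rw [h1]; rfl))))

theorem orthogonal_orthogonal : D.orthogonal.orthogonal = D := by
  funext x
  exact Submodule.orthogonal_orthogonal _

open InnerProductSpace in
-- Near x the projection is ∑ g(e_i, ·) e_i for the orthonormalized local frame.
theorem IsSmoothOfDim.isRegular {k : ℕ} (hD : D.IsSmoothOfDim k) : D.IsRegular := by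
  have hrank (x : M) : finrank ℝ (D x) = k := by
    obtain ⟨U, e, hU, hx, he⟩ := hD x
    rw [← he.span_eq x hx, finrank_span_eq_card (he.linearIndependent x hx), Fintype.card_fin]
  refine ⟨fun {x X} hX ↦ ?_, fun x y ↦ by rw [hrank, hrank]⟩
  obtain ⟨U, e, hU, hx, he⟩ := hD x
  have hs i : CMDiffAt ∞ (T% (e i)) x := (he.smooth i).contMDiffAt (hU.mem_nhds hx)
  have hli := he.linearIndependent x hx
  have hg := contMDiffAt_gramSchmidtNormed hs hli
  have hP : CMDiffAt ∞ (T% (fun y ↦ ∑ i, ((fun y ↦ (inner ℝ (gramSchmidtNormed ℝ (fun j ↦ e j y) i)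
      (X y) : ℝ)) • (fun y ↦ gramSchmidtNormed ℝ (fun j ↦ e j y) i)
        : Π y : M, TangentSpace I y) y)) x :=
    ContMDiffAt.sum_section fun i _ ↦ (contMDiffAt_inner (hg i) hX).smul_section (hg i)
  refine hP.congr_of_eventuallyEq ?_
  filter_upwards [eventually_orthonormal_gramSchmidtNormed hs hli, hU.mem_nhds hx] with y hy hyU
  have hmem i : e i y ∈ D y := he.span_eq y hyU ▸ Submodule.subset_span ⟨i, rfl⟩
  simp [← sum_inner_smul_eq_starProjection hy (gramSchmidtNormed_mem hmem) (hrank y)]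

theorem orthonormal_basisAt (D : Distribution I M) (x : M) : Orthonormal ℝ (D.basisAt x) :=
  (stdOrthonormalBasis ℝ (D x)).orthonormal.comp_linearIsometry (D x).subtypeₗᵢ

theorem basisAt_mem (D : Distribution I M) (x : M) (i : Fin (finrank ℝ (D x))) :
    D.basisAt x i ∈ D x := Submodule.coe_mem _

theorem sectionAt_mem (D : Distribution I M) (x : M) (i : Fin (finrank ℝ (D x))) (y : M) :
    D.sectionAt x i y ∈ D y := Submodule.starProjection_apply_mem _ _

theorem sectionAt_self (D : Distribution I M) (x : M) (i : Fin (finrank ℝ (D x))) :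
    D.sectionAt x i x = D.basisAt x i := by
  simp only [sectionAt, extend_apply_self]
  exact Submodule.starProjection_eq_self_iff.2 (D.basisAt_mem x i)

theorem IsRegular.contMDiffAt_sectionAt (hD : D.IsRegular) (x : M) (i : Fin (finrank ℝ (D x))) :
    CMDiffAt ∞ (T% (D.sectionAt x i)) x :=
  hD.contMDiffAt_starProjection (contMDiffAt_extend I E _)

variable (D) in
/-- An orthonormal frame of `D` near `x`, which extends the basis `D.basisAt x`. -/
def frameAt (x : M) (i : Fin (finrank ℝ (D x))) (y : M) : TangentSpace I y :=
  InnerProductSpace.gramSchmidtNormed ℝ (fun j ↦ D.sectionAt x j y) i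

theorem frameAt_mem (D : Distribution I M) (x : M) (i : Fin (finrank ℝ (D x))) (y : M) :
    D.frameAt x i y ∈ D y :=
  gramSchmidtNormed_mem (fun j ↦ D.sectionAt_mem x j y) i

theorem frameAt_self (D : Distribution I M) (x : M) (i : Fin (finrank ℝ (D x))) :
    D.frameAt x i x = D.basisAt x i := by
  simp only [frameAt, sectionAt_self]
  exact gramSchmidtNormed_of_orthonormal (D.orthonormal_basisAt x) i

theorem linearIndependent_sectionAt (D : Distribution I M) (x : M) :
    LinearIndependent ℝ (fun i ↦ D.sectionAt x i x) := by
  simp only [sectionAt_self]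
  exact (D.orthonormal_basisAt x).linearIndependent

theorem IsRegular.contMDiffAt_frameAt (hD : D.IsRegular) (x : M) (i : Fin (finrank ℝ (D x))) :
    CMDiffAt ∞ (T% (D.frameAt x i)) x :=
  contMDiffAt_gramSchmidtNormed (hD.contMDiffAt_sectionAt x) (D.linearIndependent_sectionAt x) i

theorem IsRegular.eventually_orthonormal_frameAt (hD : D.IsRegular) (x : M) :
    ∀ᶠ y in 𝓝 x, Orthonormal ℝ (fun i ↦ D.frameAt x i y) :=
  eventually_orthonormal_gramSchmidtNormed (hD.contMDiffAt_sectionAt x)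
    (D.linearIndependent_sectionAt x)

theorem sum_inner_basisAt_smul (D : Distribution I M) (x : M) (v : TangentSpace I x) :
    ∑ i, inner ℝ (D.basisAt x i) v • D.basisAt x i = (D x).starProjection v :=
  sum_inner_smul_eq_starProjection (D.orthonormal_basisAt x) (D.basisAt_mem x) rfl v

end Distribution

/-! ### Linearity of ∇ and symmetries of the curvature -/

theorem leviCivita_add {Y Y' : Π x : M, TangentSpace I x} {x : M}
    (hY : MDiffAt (T% Y) x) (hY' : MDiffAt (T% Y') x) :
    leviCivita I M (Y + Y') x = leviCivita I M Y x + leviCivita I M Y' x :=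
  (leviCivita I M).isCovariantDerivativeOnUniv.add hY hY'

theorem leviCivita_sub {Y Y' : Π x : M, TangentSpace I x} {x : M}
    (hY : MDiffAt (T% Y) x) (hY' : MDiffAt (T% Y') x) :
    leviCivita I M (Y - Y') x = leviCivita I M Y x - leviCivita I M Y' x := by
  have h := leviCivita_add (mdifferentiableAt_sub_section hY hY') hY'
  rw [sub_add_cancel] at h
  rw [h, add_sub_cancel_right]

theorem leviCivita_sum {ι : Type*} (s : Finset ι) {Y : ι → Π x : M, TangentSpace I x} {x : M}
    (hY : ∀ i, CMDiffAt ∞ (T% (Y i)) x) :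
    leviCivita I M (fun y ↦ ∑ i ∈ s, Y i y) x = ∑ i ∈ s, leviCivita I M (Y i) x := by
  classical
  induction s using Finset.induction_on with
  | empty =>
    simp only [Finset.sum_empty]
    exact congrFun (leviCivita I M).zero x
  | insert a s ha ih =>
    simp only [Finset.sum_insert ha]
    rw [← ih]
    exact leviCivita_add (mdifferentiableAt_of_contMDiffAt (hY a))
      (mdifferentiableAt_of_contMDiffAt (ContMDiffAt.sum_section fun i _ ↦ hY i))

/-- Differentiating `g(Y, Z) = const`. -/
theorem inner_leviCivita_of_const {Y Z : Π x : M, TangentSpace I x} {x : M} {c : ℝ}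
    (hY : MDiffAt (T% Y) x) (hZ : MDiffAt (T% Z) x) (h : ∀ᶠ y in 𝓝 x, inner ℝ (Y y) (Z y) = c)
    (v : TangentSpace I x) :
    inner ℝ (leviCivita I M Y x v) (Z x) = - inner ℝ (Y x) (leviCivita I M Z x v) := by
  have h1 := mvfderiv_inner v hY hZ
  rw [mvfderiv_eq_zero_of_eventually_const h] at h1
  simp only [zero_apply] at h1
  linarith

section Curvature

variable {X Y Z W : Π x : M, TangentSpace I x} {x : M}

theorem curvature_swap : curvature Y X Z x = - curvature X Y Z x := by
  simp only [curvature, mlieBracket_swap_apply (V := Y) (W := X), map_neg]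
  abel

theorem mvfderiv_mvfderiv_inner (hY : CMDiffAt ∞ (T% Y) x)
    (hZ : CMDiffAt ∞ (T% Z) x) (hW : CMDiffAt ∞ (T% W) x) :
    mvfderiv I (fun y ↦ mvfderiv I (fun z ↦ inner ℝ (Z z) (W z)) y (Y y)) x (X x)
      = inner ℝ (covDeriv X (covDeriv Y Z) x) (W x)
        + inner ℝ (covDeriv Y Z x) (covDeriv X W x)
        + inner ℝ (covDeriv X Z x) (covDeriv Y W x)
        + inner ℝ (Z x) (covDeriv X (covDeriv Y W) x) := by
  have e : (fun y ↦ mvfderiv I (fun z ↦ inner ℝ (Z z) (W z)) y (Y y)) =ᶠ[𝓝 x]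
      fun y ↦ inner ℝ (covDeriv Y Z y) (W y) + inner ℝ (Z y) (covDeriv Y W y) := by
    filter_upwards [eventually_mdifferentiableAt hZ, eventually_mdifferentiableAt hW] with y h1 h2
    exact mvfderiv_inner _ h1 h2
  have hYZ := mdifferentiableAt_of_contMDiffAt (contMDiffAt_covDeriv hY hZ)
  have hYW := mdifferentiableAt_of_contMDiffAt (contMDiffAt_covDeriv hY hW)
  have hZ' := mdifferentiableAt_of_contMDiffAt hZ
  have hW' := mdifferentiableAt_of_contMDiffAt hW
  rw [mvfderiv_congr e, mvfderiv_fun_add (mdifferentiableAt_inner hYZ hW')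
    (mdifferentiableAt_inner hZ' hYW), add_apply, mvfderiv_inner _ hYZ hW',
    mvfderiv_inner _ hZ' hYW]
  ring

/-- Apply [X, Y] = XY - YX to the function g(Z, W) and expand with metric compatibility. The
products of first derivatives cancel. -/
theorem inner_curvature_skew (hX : CMDiffAt ∞ (T% X) x) (hY : CMDiffAt ∞ (T% Y) x)
    (hZ : CMDiffAt ∞ (T% Z) x) (hW : CMDiffAt ∞ (T% W) x) :
    inner ℝ (curvature X Y Z x) (W x) = - inner ℝ (Z x) (curvature X Y W x) := by
  have h := mvfderiv_mlieBracket (contMDiffAt_inner hZ hW) hX hY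
  rw [mvfderiv_mvfderiv_inner hY hZ hW, mvfderiv_mvfderiv_inner hX hZ hW,
    mvfderiv_inner _ (mdifferentiableAt_of_contMDiffAt hZ)
      (mdifferentiableAt_of_contMDiffAt hW)] at h
  simp only [curvature, inner_sub_left, inner_sub_right]
  simp only [covDeriv] at h
  linarith

/-- Vanishing torsion turns the cyclic sum into a cyclic sum of double brackets, which is zero by
Jacobi. -/
theorem curvature_bianchi (hX : CMDiffAt ∞ (T% X) x) (hY : CMDiffAt ∞ (T% Y) x)
    (hZ : CMDiffAt ∞ (T% Z) x) :
    curvature X Y Z x + curvature Y Z X x + curvature Z X Y x = 0 := by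
  have : CompleteSpace E := FiniteDimensional.complete ℝ E
  have h2 : minSmoothness ℝ 2 ≤ ∞ := by simp; norm_cast
  have : IsManifold I (minSmoothness ℝ 3) M :=
    IsManifold.of_le (n := ∞) (by simp; norm_cast)
  have key {X Y Z : Π x : M, TangentSpace I x} (hX : CMDiffAt ∞ (T% X) x)
      (hY : CMDiffAt ∞ (T% Y) x) (hZ : CMDiffAt ∞ (T% Z) x) :
      covDeriv X (covDeriv Y Z) x - covDeriv X (covDeriv Z Y) x
        = mlieBracket I X (mlieBracket I Y Z) x + leviCivita I M X x (mlieBracket I Y Z x) := by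
    have hYZ := mdifferentiableAt_of_contMDiffAt (contMDiffAt_covDeriv hY hZ)
    have hZY := mdifferentiableAt_of_contMDiffAt (contMDiffAt_covDeriv hZ hY)
    have hB := mdifferentiableAt_of_contMDiffAt (contMDiffAt_mlieBracket hY hZ)
    rw [← leviCivita_sub_leviCivita (mdifferentiableAt_of_contMDiffAt hX) hB, sub_add_cancel,
      ← sub_apply, ← leviCivita_sub hYZ hZY]
    refine congrArg (fun A : TangentSpace I x →L[ℝ] TangentSpace I x ↦ A (X x))
      (leviCivita_congr (mdifferentiableAt_sub_section hYZ hZY) hB ?_)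
    filter_upwards [eventually_mdifferentiableAt hY, eventually_mdifferentiableAt hZ] with y h1 h2
    exact leviCivita_sub_leviCivita h1 h2
  have k1 := key hX hY hZ
  have k2 := key hY hZ hX
  have k3 := key hZ hX hY
  have J := leibniz_identity_mlieBracket_apply (hX.of_le h2) (hY.of_le h2) (hZ.of_le h2)
  have s1 : mlieBracket I (mlieBracket I X Y) Z x = - mlieBracket I Z (mlieBracket I X Y) x :=
    mlieBracket_swap_apply
  have s2 : mlieBracket I Y (mlieBracket I X Z) x = - mlieBracket I Y (mlieBracket I Z X) x := by
    rw [mlieBracket_swap (V := X) (W := Z)]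
    have := mlieBracket_const_smul_right (V := Y) (c := (-1 : ℝ))
      (mdifferentiableAt_of_contMDiffAt (contMDiffAt_mlieBracket hZ hX))
    simpa using this
  rw [s1, s2] at J
  simp only [covDeriv] at k1 k2 k3
  simp only [curvature]
  calc _ = (mlieBracket I X (mlieBracket I Y Z) x)
        + (mlieBracket I Y (mlieBracket I Z X) x) + (mlieBracket I Z (mlieBracket I X Y) x) := by
        rw [eq_sub_of_add_eq k1.symm, eq_sub_of_add_eq k2.symm, eq_sub_of_add_eq k3.symm]
        abel
    _ = 0 := by
        rw [J]
        abel

theorem inner_curvature_pair_symm (hX : CMDiffAt ∞ (T% X) x) (hY : CMDiffAt ∞ (T% Y) x)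
    (hZ : CMDiffAt ∞ (T% Z) x) (hW : CMDiffAt ∞ (T% W) x) :
    inner ℝ (curvature X Y Z x) (W x) = inner ℝ (curvature Z W X x) (Y x) := by
  have b {X Y Z : Π x : M, TangentSpace I x} (W : Π x : M, TangentSpace I x)
      (hX : CMDiffAt ∞ (T% X) x) (hY : CMDiffAt ∞ (T% Y) x) (hZ : CMDiffAt ∞ (T% Z) x) :
      inner ℝ (curvature X Y Z x) (W x) + inner ℝ (curvature Y Z X x) (W x)
        + inner ℝ (curvature Z X Y x) (W x) = 0 := by
    rw [← inner_add_left, ← inner_add_left, curvature_bianchi hX hY hZ, inner_zero_left]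
  have s {X Y Z W : Π x : M, TangentSpace I x} (hX : CMDiffAt ∞ (T% X) x)
      (hY : CMDiffAt ∞ (T% Y) x) (hZ : CMDiffAt ∞ (T% Z) x) (hW : CMDiffAt ∞ (T% W) x) :
      inner ℝ (curvature X Y Z x) (W x) = - inner ℝ (curvature X Y W x) (Z x) := by
    rw [inner_curvature_skew hX hY hZ hW, real_inner_comm]
  have a (X Y Z W : Π x : M, TangentSpace I x) :
      inner ℝ (curvature X Y Z x) (W x) = - inner ℝ (curvature Y X Z x) (W x) := by
    rw [curvature_swap, inner_neg_left]
  -- Four Bianchi identities, one for each vector placed in the last slot. The two skew symmetries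
  -- reduce a signed combination of them to the claim.
  have b1 := b W hX hY hZ
  have b2 := b X hY hZ hW
  have b3 := b Y hZ hW hX
  have b4 := b Z hW hX hY
  have s1 := s hX hY hZ hW
  have s2 := s hY hZ hX hW
  have s3 := s hZ hX hY hW
  have s4 := s hY hW hX hZ
  have s5 := s hW hX hY hZ
  have s6 := s hZ hW hX hY
  have a1 := a W Y Z X
  have a2 := a X Z W Y
  have a3 := a X W Z Y
  have a4 := a X Y W Z
  have a5 := a W X Z Y
  have a6 := a Z X W Y
  have a7 := a W Y X Z
  linarith

/-- Independence of the extensions follows from the symmetries alone. The last slot of g(R(·,·)·, ·)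
sees only the value at x, and skewness together with pair symmetry brings each of the four arguments
into that slot, where it can be exchanged. -/
theorem sectionalCurvature_eq (hX : CMDiffAt ∞ (T% X) x) (hY : CMDiffAt ∞ (T% Y) x)
    (h1 : ‖X x‖ = 1) (h2 : ‖Y x‖ = 1) (h3 : inner ℝ (X x) (Y x) = 0) :
    sectionalCurvature x (X x) (Y x) = inner ℝ (curvature X Y Y x) (X x) := by
  have hU : CMDiffAt ∞ (T% (extend E (X x) : Π y : M, TangentSpace I y)) x :=
    contMDiffAt_extend I E _
  have hV : CMDiffAt ∞ (T% (extend E (Y x) : Π y : M, TangentSpace I y)) x :=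
    contMDiffAt_extend I E _
  have eU : (extend E (X x) : Π y : M, TangentSpace I y) x = X x := extend_apply_self _ _
  have eV : (extend E (Y x) : Π y : M, TangentSpace I y) x = Y x := extend_apply_self _ _
  rw [sectionalCurvature, h1, h2, h3]
  have t1 := inner_curvature_skew hU hV hV hX
  have t2 := inner_curvature_skew hU hV hY hX
  have t3 := inner_curvature_pair_symm hU hV hY hX
  have t4 := inner_curvature_skew hY hX hU hV
  have t5 := inner_curvature_skew hY hX hX hV
  have t6 : inner ℝ (curvature Y X X x) (Y x) = inner ℝ (curvature X Y Y x) (X x) := by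
    rw [curvature_swap, inner_neg_left, inner_curvature_skew hX hY hX hY, neg_neg,
      real_inner_comm]
  simp only [eU, eV] at t1 t2 t3 t4 t5
  linarith

end Curvature

/-! ### Compressed traces and the second form of a distribution -/

theorem inner_starProjection_left {F : Type*} [NormedAddCommGroup F] [InnerProductSpace ℝ F]
    (K : Submodule ℝ F) [K.HasOrthogonalProjection] (u v : F) :
    inner ℝ (K.starProjection u) v = inner ℝ u (K.starProjection v) :=
  Submodule.inner_starProjection_left_eq_right K u v

/-- The trace of the compression of `A` to `K` may be computed in any orthonormal basis. -/
theorem sum_inner_apply_eq {k l : ℕ} {F : Type*} [NormedAddCommGroup F]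
    [InnerProductSpace ℝ F] {K : Submodule ℝ F} [FiniteDimensional ℝ K] {f : Fin k → F}
    {g : Fin l → F} (hf : Orthonormal ℝ f) (hfK : ∀ i, f i ∈ K) (hk : finrank ℝ K = k)
    (hg : Orthonormal ℝ g) (hgK : ∀ i, g i ∈ K) (hl : finrank ℝ K = l) (A : F →L[ℝ] F) :
    ∑ i, inner ℝ (A (f i)) (f i) = ∑ j, inner ℝ (A (g j)) (g j) := by
  have h1 i : f i = ∑ j, inner ℝ (g j) (f i) • g j := by
    rw [sum_inner_smul_eq_starProjection hg hgK hl, Submodule.starProjection_eq_self_iff.2 (hfK i)]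
  have h2 j : g j = ∑ i, inner ℝ (f i) (g j) • f i := by
    rw [sum_inner_smul_eq_starProjection hf hfK hk, Submodule.starProjection_eq_self_iff.2 (hgK j)]
  calc ∑ i, inner ℝ (A (f i)) (f i)
      = ∑ i, ∑ j, inner ℝ (f i) (g j) * inner ℝ (A (f i)) (g j) := by
        refine Finset.sum_congr rfl fun i _ ↦ ?_
        conv_lhs => arg 3; rw [h1 i]
        simp only [inner_sum, inner_smul_right, real_inner_comm (g _) (f i)]
    _ = ∑ j, inner ℝ (A (∑ i, inner ℝ (f i) (g j) • f i)) (g j) := by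
        rw [Finset.sum_comm]
        refine Finset.sum_congr rfl fun j _ ↦ ?_
        simp only [map_sum, map_smul, sum_inner, inner_smul_left]
        rfl
    _ = _ := by simp only [← h2]

namespace Distribution

variable {D : Distribution I M} {x : M}

variable (D) in
/-- A section of `D` extending the vector `v ∈ D x`. -/
def extendSection (x : M) (v : TangentSpace I x) (y : M) : TangentSpace I y :=
  (D y).starProjection (extend E v y)

theorem extendSection_mem (v : TangentSpace I x) (y : M) : D.extendSection x v y ∈ D y :=
  Submodule.starProjection_apply_mem _ _

theorem extendSection_self (v : TangentSpace I x) :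
    D.extendSection x v x = (D x).starProjection v := by
  simp [extendSection]

theorem IsRegular.contMDiffAt_extendSection (hD : D.IsRegular) (v : TangentSpace I x) :
    CMDiffAt ∞ (T% (D.extendSection x v)) x :=
  hD.contMDiffAt_starProjection (contMDiffAt_extend I E _)

theorem inner_eq_zero_of_mem {y : M} {u v : TangentSpace I y} (hu : u ∈ D y)
    (hv : v ∈ D.orthogonal y) : inner ℝ u v = 0 :=
  (Submodule.mem_orthogonal _ _).1 hv u hu

theorem inner_eq_zero_of_mem' {y : M} {u v : TangentSpace I y} (hu : u ∈ D y)
    (hv : v ∈ D.orthogonal y) : inner ℝ v u = 0 := by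
  rw [real_inner_comm, inner_eq_zero_of_mem hu hv]

theorem starProjection_add_starProjection_orthogonal (v : TangentSpace I x) :
    (D x).starProjection v + (D.orthogonal x).starProjection v = v :=
  Submodule.starProjection_add_starProjection_orthogonal v

/-- Differentiating `g(Y, Z) = 0` for sections `Y` of `D` and `Z` of `D^⊥`. -/
theorem inner_leviCivita_of_mem {Y Z : Π x : M, TangentSpace I x} (hY : MDiffAt (T% Y) x)
    (hZ : MDiffAt (T% Z) x) (hYD : ∀ y, Y y ∈ D y) (hZD : ∀ y, Z y ∈ D.orthogonal y)
    (v : TangentSpace I x) :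
    inner ℝ (leviCivita I M Y x v) (Z x) = - inner ℝ (Y x) (leviCivita I M Z x v) :=
  inner_leviCivita_of_const hY hZ
    (Filter.Eventually.of_forall fun y ↦ inner_eq_zero_of_mem (hYD y) (hZD y)) v

variable (D) in
/-- The tensor `(∇_u Y)^⊥`, where `Y` is a section of `D` with `Y x = v`. -/
def secondForm (x : M) (u v : TangentSpace I x) : TangentSpace I x :=
  (D.orthogonal x).starProjection (leviCivita I M (D.extendSection x v) x u)

theorem secondForm_mem (u v : TangentSpace I x) : D.secondForm x u v ∈ D.orthogonal x :=
  Submodule.starProjection_apply_mem _ _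

theorem IsRegular.inner_starProjection_leviCivita (hD : D.IsRegular)
    {Y : Π x : M, TangentSpace I x} (hY : MDiffAt (T% Y) x) (hYD : ∀ y, Y y ∈ D y)
    (u w : TangentSpace I x) :
    inner ℝ ((D.orthogonal x).starProjection (leviCivita I M Y x u)) w
      = - inner ℝ (Y x) (leviCivita I M (D.orthogonal.extendSection x w) x u) := by
  rw [inner_starProjection_left, ← extendSection_self]
  exact inner_leviCivita_of_mem hY
    (mdifferentiableAt_of_contMDiffAt (hD.orthogonal.contMDiffAt_extendSection w)) hYD
    (fun y ↦ extendSection_mem w y) u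

/-- Tensoriality: paired with w, the left side is -g(Y, ∇_u W) for a section W of D^⊥, and this
involves Y only through its value at x. -/
theorem IsRegular.starProjection_leviCivita (hD : D.IsRegular)
    {Y : Π x : M, TangentSpace I x} (hY : MDiffAt (T% Y) x) (hYD : ∀ y, Y y ∈ D y)
    (u : TangentSpace I x) :
    (D.orthogonal x).starProjection (leviCivita I M Y x u) = D.secondForm x u (Y x) := by
  refine ext_inner_right ℝ fun w ↦ ?_
  rw [secondForm, hD.inner_starProjection_leviCivita hY hYD,
    hD.inner_starProjection_leviCivita
      (mdifferentiableAt_of_contMDiffAt (hD.contMDiffAt_extendSection _))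
      (fun y ↦ extendSection_mem _ y), extendSection_self,
    Submodule.starProjection_eq_self_iff.2 (hYD x)]

theorem IsRegular.inner_leviCivita_eq (hD : D.IsRegular)
    {Y : Π x : M, TangentSpace I x} (hY : MDiffAt (T% Y) x) (hYD : ∀ y, Y y ∈ D y)
    (u : TangentSpace I x) {w : TangentSpace I x} (hw : w ∈ D.orthogonal x) :
    inner ℝ (leviCivita I M Y x u) w = inner ℝ (D.secondForm x u (Y x)) w := by
  rw [← hD.starProjection_leviCivita hY hYD, inner_starProjection_left,
    Submodule.starProjection_eq_self_iff.2 hw]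

/-- The second forms of D and D^⊥ carry the same data: for fixed u each is minus the adjoint of the
other, since g(Y, W) = 0 for sections of the two distributions. -/
theorem IsRegular.inner_secondForm (hD : D.IsRegular) (u : TangentSpace I x)
    {v : TangentSpace I x} (w : TangentSpace I x) (hv : v ∈ D x) :
    inner ℝ (D.secondForm x u v) w = - inner ℝ v (D.orthogonal.secondForm x u w) := by
  rw [secondForm, hD.inner_starProjection_leviCivita
      (mdifferentiableAt_of_contMDiffAt (hD.contMDiffAt_extendSection _))
      (fun y ↦ extendSection_mem _ y), extendSection_self,
    Submodule.starProjection_eq_self_iff.2 hv,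
    ← Submodule.starProjection_eq_self_iff.2 hv, inner_starProjection_left]
  simp only [secondForm, orthogonal_orthogonal]
  rw [Submodule.starProjection_eq_self_iff.2 hv]

theorem IsRegular.secondFundamentalForm_eq (hD : D.IsRegular)
    {X Y : Π x : M, TangentSpace I x} (hX : MDiffAt (T% X) x) (hY : MDiffAt (T% Y) x)
    (hXD : ∀ y, X y ∈ D y) (hYD : ∀ y, Y y ∈ D y) :
    D.secondFundamentalForm X Y x
      = (1 / 2 : ℝ) • (D.secondForm x (X x) (Y x) + D.secondForm x (Y x) (X x)) := by
  rw [secondFundamentalForm, map_smul, map_add, hD.starProjection_leviCivita hX hXD,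
    hD.starProjection_leviCivita hY hYD]

theorem IsRegular.integrabilityTensor_eq (hD : D.IsRegular)
    {X Y : Π x : M, TangentSpace I x} (hX : MDiffAt (T% X) x) (hY : MDiffAt (T% Y) x)
    (hXD : ∀ y, X y ∈ D y) (hYD : ∀ y, Y y ∈ D y) :
    D.integrabilityTensor X Y x = D.secondForm x (X x) (Y x) - D.secondForm x (Y x) (X x) := by
  rw [integrabilityTensor, ← leviCivita_sub_leviCivita hX hY, map_sub,
    hD.starProjection_leviCivita hX hXD, hD.starProjection_leviCivita hY hYD]

/-- Polarization: |½(a + b)|² - ¼|a - b|² = g(a, b) with a = h(e_i, e_j) and b = h(e_j, e_i). -/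
theorem IsRegular.normSq_sub_normSq (hD : D.IsRegular) (x : M) :
    D.normSqSecondFundamentalForm x - 1 / 4 * D.normSqIntegrabilityTensor x
      = ∑ i, ∑ j, inner ℝ (D.secondForm x (D.basisAt x i) (D.basisAt x j))
          (D.secondForm x (D.basisAt x j) (D.basisAt x i)) := by
  simp only [normSqSecondFundamentalForm, normSqIntegrabilityTensor, Finset.mul_sum,
    ← Finset.sum_sub_distrib]
  refine Finset.sum_congr rfl fun i _ ↦ Finset.sum_congr rfl fun j _ ↦ ?_
  have hs i := mdifferentiableAt_of_contMDiffAt (hD.contMDiffAt_sectionAt x i)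
  rw [hD.secondFundamentalForm_eq (hs i) (hs j) (D.sectionAt_mem x i) (D.sectionAt_mem x j),
    hD.integrabilityTensor_eq (hs i) (hs j) (D.sectionAt_mem x i) (D.sectionAt_mem x j)]
  simp only [sectionAt_self, norm_smul, mul_pow, norm_add_sq_real, norm_sub_sq_real]
  norm_num
  ring

theorem IsRegular.traceSecondFundamentalForm_eq_sum_secondForm (hD : D.IsRegular) (x : M) :
    D.traceSecondFundamentalForm x
      = ∑ i, D.secondForm x (D.basisAt x i) (D.basisAt x i) := by
  refine Finset.sum_congr rfl fun i _ ↦ ?_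
  have hs i := mdifferentiableAt_of_contMDiffAt (hD.contMDiffAt_sectionAt x i)
  rw [hD.secondFundamentalForm_eq (hs i) (hs i) (D.sectionAt_mem x i) (D.sectionAt_mem x i),
    sectionAt_self, ← two_smul ℝ, smul_smul]
  norm_num

/-- The trace of the second fundamental form in an arbitrary orthonormal frame. -/
theorem IsRegular.traceSecondFundamentalForm_eq {k : ℕ} (hD : D.IsRegular)
    {e : Fin k → Π x : M, TangentSpace I x} (hk : finrank ℝ (D x) = k)
    (he : ∀ i, MDiffAt (T% (e i)) x) (heD : ∀ i y, e i y ∈ D y)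
    (ho : Orthonormal ℝ (fun i ↦ e i x)) :
    D.traceSecondFundamentalForm x
      = ∑ i, (D.orthogonal x).starProjection (covDeriv (e i) (e i) x) := by
  rw [hD.traceSecondFundamentalForm_eq_sum_secondForm]
  refine ext_inner_right ℝ fun w ↦ ?_
  simp only [sum_inner]
  have hs i := mdifferentiableAt_of_contMDiffAt (hD.contMDiffAt_sectionAt x i)
  -- Paired with w, the trace of B^D is minus the trace over D of v ↦ ∇_v W, which is independent of
  -- the orthonormal basis.
  have h := sum_inner_apply_eq (D.orthonormal_basisAt x) (D.basisAt_mem x) rfl ho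
    (fun i ↦ heD i x) hk (leviCivita I M (D.orthogonal.extendSection x w) x)
  calc _ = ∑ i, - inner ℝ (leviCivita I M (D.orthogonal.extendSection x w) x (D.basisAt x i))
        (D.basisAt x i) := by
        refine Finset.sum_congr rfl fun i _ ↦ ?_
        have := hD.starProjection_leviCivita (hs i) (D.sectionAt_mem x i) (D.basisAt x i)
        rw [sectionAt_self] at this
        rw [← this, hD.inner_starProjection_leviCivita (hs i) (D.sectionAt_mem x i),
          sectionAt_self, real_inner_comm]
    _ = _ := by
        rw [Finset.sum_neg_distrib, h, ← Finset.sum_neg_distrib]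
        refine Finset.sum_congr rfl fun i _ ↦ ?_
        rw [covDeriv, hD.inner_starProjection_leviCivita (he i) (heD i), real_inner_comm]

/-- The trace is defined with an unrelated basis at each point. This expresses it near x in one
smooth frame, so that it can be differentiated. -/
theorem IsRegular.eventually_traceSecondFundamentalForm_eq (hD : D.IsRegular) (x : M) :
    ∀ᶠ y in 𝓝 x, D.traceSecondFundamentalForm y = ∑ i,
      (D.orthogonal y).starProjection (covDeriv (D.frameAt x i) (D.frameAt x i) y) := by
  filter_upwards [hD.eventually_orthonormal_frameAt x,
    Filter.eventually_all.2 fun i ↦ eventually_mdifferentiableAt (hD.contMDiffAt_frameAt x i)]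
    with y h1 h2
  exact hD.traceSecondFundamentalForm_eq (hD.finrank_eq y x) h2 (D.frameAt_mem x) h1

theorem IsRegular.contMDiffAt_starProjection_covDeriv_frameAt (hD : D.IsRegular) (x : M)
    (i : Fin (finrank ℝ (D x))) :
    CMDiffAt ∞ (T% (fun y ↦ (D.orthogonal y).starProjection
      (covDeriv (D.frameAt x i) (D.frameAt x i) y))) x :=
  hD.orthogonal.contMDiffAt_starProjection
    (contMDiffAt_covDeriv (hD.contMDiffAt_frameAt x i) (hD.contMDiffAt_frameAt x i))

theorem IsRegular.contMDiffAt_traceSecondFundamentalForm (hD : D.IsRegular) (x : M) :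
    CMDiffAt ∞ (T% D.traceSecondFundamentalForm) x := by
  have h : CMDiffAt ∞ (T% (fun y ↦ ∑ i, (D.orthogonal y).starProjection
      (covDeriv (D.frameAt x i) (D.frameAt x i) y))) x :=
    ContMDiffAt.sum_section fun i _ ↦ hD.contMDiffAt_starProjection_covDeriv_frameAt x i
  refine h.congr_of_eventuallyEq ?_
  filter_upwards [hD.eventually_traceSecondFundamentalForm_eq x] with y hy
  rw [hy]

theorem IsRegular.divergenceAlong_trace (hD : D.IsRegular) (x : M) :
    D.orthogonal.divergenceAlong D.traceSecondFundamentalForm x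
      = ∑ a, ∑ i, inner ℝ (leviCivita I M (fun y ↦ (D.orthogonal y).starProjection
          (covDeriv (D.frameAt x i) (D.frameAt x i) y)) x (D.orthogonal.basisAt x a))
          (D.orthogonal.basisAt x a) := by
  have h := leviCivita_sum Finset.univ
    (hD.contMDiffAt_starProjection_covDeriv_frameAt x)
  have h' := leviCivita_congr
    (mdifferentiableAt_of_contMDiffAt (hD.contMDiffAt_traceSecondFundamentalForm x))
    (mdifferentiableAt_of_contMDiffAt (ContMDiffAt.sum_section fun i _ ↦
      hD.contMDiffAt_starProjection_covDeriv_frameAt x i))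
    (hD.eventually_traceSecondFundamentalForm_eq x)
  refine Finset.sum_congr rfl fun a _ ↦ ?_
  rw [h', h, sum_apply, sum_inner]

end Distribution

/-! ### Walczak's formula -/

namespace Distribution

variable {D : Distribution I M} {x : M}

theorem IsRegular.leviCivita_eq_add (hD : D.IsRegular) {X : Π x : M, TangentSpace I x}
    (hX : CMDiffAt ∞ (T% X) x) (v : TangentSpace I x) :
    leviCivita I M X x v = leviCivita I M (fun y ↦ (D y).starProjection (X y)) x v
      + leviCivita I M (fun y ↦ (D.orthogonal y).starProjection (X y)) x v := by
  rw [← add_apply, ← leviCivita_add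
    (mdifferentiableAt_of_contMDiffAt (hD.contMDiffAt_starProjection hX))
    (mdifferentiableAt_of_contMDiffAt (hD.orthogonal.contMDiffAt_starProjection hX))]
  congr 2
  funext y
  exact (starProjection_add_starProjection_orthogonal (X y)).symm

/-- The mixed curvature of two sections `X` of `D` and `Y` of `D^⊥`. -/
theorem IsRegular.inner_curvature_mixed (hD : D.IsRegular) {X Y : Π x : M, TangentSpace I x}
    (hX : CMDiffAt ∞ (T% X) x) (hY : CMDiffAt ∞ (T% Y) x)
    (hXD : ∀ y, X y ∈ D y) (hYD : ∀ y, Y y ∈ D.orthogonal y) :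
    inner ℝ (curvature X Y Y x) (X x)
      = inner ℝ (leviCivita I M (fun y ↦ (D y).starProjection (covDeriv Y Y y)) x (X x)) (X x)
        + inner ℝ (leviCivita I M (fun y ↦ (D.orthogonal y).starProjection (covDeriv X X y)) x
            (Y x)) (Y x)
        + inner ℝ (covDeriv X Y x) (covDeriv Y X x)
        - inner ℝ (leviCivita I M Y x (covDeriv X Y x)) (X x)
        + inner ℝ (leviCivita I M Y x (covDeriv Y X x)) (X x) := by
  have hXd := mdifferentiableAt_of_contMDiffAt hX
  have hYd := mdifferentiableAt_of_contMDiffAt hY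
  have hYY := contMDiffAt_covDeriv hY hY
  have hXX := contMDiffAt_covDeriv hX hX
  have hXY := contMDiffAt_covDeriv hX hY
  have hXXd := mdifferentiableAt_of_contMDiffAt hXX
  -- the normal part of `∇_Y Y`
  have e1 : inner ℝ (leviCivita I M (fun y ↦ (D.orthogonal y).starProjection (covDeriv Y Y y)) x
      (X x)) (X x) = - inner ℝ ((D.orthogonal x).starProjection (covDeriv Y Y x))
        (covDeriv X X x) :=
    inner_leviCivita_of_const (c := 0)
      (mdifferentiableAt_of_contMDiffAt (hD.orthogonal.contMDiffAt_starProjection hYY)) hXd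
      (Filter.Eventually.of_forall fun y ↦
        inner_eq_zero_of_mem' (hXD y) (Submodule.starProjection_apply_mem _ _)) _
  -- the tangential part of `∇_X X`
  have e2 : inner ℝ (leviCivita I M (fun y ↦ (D y).starProjection (covDeriv X X y)) x (Y x)) (Y x)
      = - inner ℝ ((D x).starProjection (covDeriv X X x)) (covDeriv Y Y x) :=
    inner_leviCivita_of_const (c := 0)
      (mdifferentiableAt_of_contMDiffAt (hD.contMDiffAt_starProjection hXX)) hYd
      (Filter.Eventually.of_forall fun y ↦
        inner_eq_zero_of_mem (Submodule.starProjection_apply_mem _ _) (hYD y)) _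
  -- the derivative of `g(∇_X Y, X) = - g(∇_X X, Y)` along `Y`
  have e3 : inner ℝ (covDeriv Y (covDeriv X Y) x) (X x)
        + inner ℝ (covDeriv X Y x) (covDeriv Y X x)
      = - (inner ℝ (covDeriv Y (covDeriv X X) x) (Y x)
        + inner ℝ (covDeriv X X x) (covDeriv Y Y x)) := by
    rw [← mvfderiv_inner _ (mdifferentiableAt_of_contMDiffAt hXY) hXd,
      ← mvfderiv_inner _ hXXd hYd, ← neg_apply, ← mvfderiv_fun_neg]
    refine congrArg (fun A : TangentSpace I x →L[ℝ] ℝ ↦ A (Y x)) (mvfderiv_congr ?_)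
    filter_upwards [eventually_mdifferentiableAt hX, eventually_mdifferentiableAt hY] with y h1 h2
    rw [real_inner_comm, ← neg_eq_iff_eq_neg]
    exact (inner_leviCivita_of_mem h1 h2 hXD hYD (X y)).symm
  -- Splitting ∇_Y Y and ∇_X X into their parts in D and D^⊥ isolates the two divergence terms. The
  -- remaining pieces from `e1`, `e2` and `e3` are multiples of g(∇_X X, ∇_Y Y) and its two parts,
  -- and they add up to zero.
  have e4 := hD.leviCivita_eq_add hYY (X x)
  have e5 := hD.leviCivita_eq_add hXX (Y x)
  have e6 : inner ℝ ((D x).starProjection (covDeriv X X x)) (covDeriv Y Y x)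
      = inner ℝ (covDeriv X X x) ((D x).starProjection (covDeriv Y Y x)) :=
    inner_starProjection_left _ _ _
  have e7 : inner ℝ (covDeriv X X x) (covDeriv Y Y x)
      = inner ℝ (covDeriv X X x) ((D x).starProjection (covDeriv Y Y x))
        + inner ℝ (covDeriv X X x) ((D.orthogonal x).starProjection (covDeriv Y Y x)) := by
    rw [← inner_add_right, starProjection_add_starProjection_orthogonal]
  have e8 := congrArg (fun v ↦ inner ℝ v (Y x)) e5
  have e9 := real_inner_comm (covDeriv X X x) ((D.orthogonal x).starProjection (covDeriv Y Y x))
  rw [curvature, ← leviCivita_sub_leviCivita hXd hYd]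
  change inner ℝ (leviCivita I M (covDeriv Y Y) x (X x) - leviCivita I M (covDeriv X Y) x (Y x)
    - leviCivita I M Y x (covDeriv X Y x - covDeriv Y X x)) (X x) = _
  rw [e4]
  simp only [inner_sub_left, inner_add_left, map_sub] at e8 ⊢
  linarith

theorem inner_eq_sum_basisAt (D : Distribution I M) (u v : TangentSpace I x) :
    inner ℝ u v = ∑ i, inner ℝ u (D.basisAt x i) * inner ℝ v (D.basisAt x i)
      + ∑ a, inner ℝ u (D.orthogonal.basisAt x a) * inner ℝ v (D.orthogonal.basisAt x a) := by
  have h (D : Distribution I M) : ∑ i, inner ℝ u (D.basisAt x i) * inner ℝ v (D.basisAt x i)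
      = inner ℝ u ((D x).starProjection v) := by
    rw [← sum_inner_basisAt_smul, inner_sum]
    refine Finset.sum_congr rfl fun i _ ↦ ?_
    rw [inner_smul_right, real_inner_comm v, mul_comm]
  rw [h, h, ← inner_add_right, starProjection_add_starProjection_orthogonal]

theorem inner_eq_sum_basisAt_of_mem {u v : TangentSpace I x} (hv : v ∈ D x) :
    inner ℝ u v = ∑ i, inner ℝ u (D.basisAt x i) * inner ℝ v (D.basisAt x i) := by
  rw [inner_eq_sum_basisAt D u v]
  simp [inner_eq_zero_of_mem hv (D.orthogonal.basisAt_mem x _)]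

theorem apply_eq_sum_basisAt (D : Distribution I M) (A : TangentSpace I x →L[ℝ] TangentSpace I x)
    (u w : TangentSpace I x) :
    inner ℝ (A u) w = ∑ i, inner ℝ u (D.basisAt x i) * inner ℝ (A (D.basisAt x i)) w
      + ∑ a, inner ℝ u (D.orthogonal.basisAt x a) * inner ℝ (A (D.orthogonal.basisAt x a)) w := by
  have h (D : Distribution I M) : ∑ i, inner ℝ u (D.basisAt x i) * inner ℝ (A (D.basisAt x i)) w
      = inner ℝ (A ((D x).starProjection u)) w := by
    rw [← sum_inner_basisAt_smul, map_sum, sum_inner]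
    refine Finset.sum_congr rfl fun i _ ↦ ?_
    rw [map_smul, inner_smul_left, real_inner_comm u]
    rfl
  rw [h, h, ← inner_add_left, ← map_add, starProjection_add_starProjection_orthogonal]

theorem sum_skew_mul_symm {ι : Type*} [Fintype ι] {θ t : ι → ι → ℝ}
    (hθ : ∀ i j, θ i j = - θ j i) : ∑ i, ∑ j, θ i j * (t i j + t j i) = 0 := by
  have h : ∑ i, ∑ j, θ i j * (t i j + t j i) = - ∑ i, ∑ j, θ i j * (t i j + t j i) := by
    conv_lhs => rw [Finset.sum_comm]
    simp only [← Finset.sum_neg_distrib]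
    refine Finset.sum_congr rfl fun i _ ↦ Finset.sum_congr rfl fun j _ ↦ ?_
    rw [hθ j i]
    ring
  linarith

/-- The frame products g(E_i, E_j) are constantly δ_ij near x. -/
theorem IsRegular.inner_leviCivita_frameAt_skew (hD : D.IsRegular) (v : TangentSpace I x)
    (i j : Fin (finrank ℝ (D x))) :
    inner ℝ (leviCivita I M (D.frameAt x i) x v) (D.basisAt x j)
      = - inner ℝ (leviCivita I M (D.frameAt x j) x v) (D.basisAt x i) := by
  have h := inner_leviCivita_of_const (c := if i = j then 1 else 0)
    (mdifferentiableAt_of_contMDiffAt (hD.contMDiffAt_frameAt x i))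
    (mdifferentiableAt_of_contMDiffAt (hD.contMDiffAt_frameAt x j))
    (by
      filter_upwards [hD.eventually_orthonormal_frameAt x] with y hy
      exact orthonormal_iff_ite.1 hy i j) v
  rw [frameAt_self, frameAt_self] at h
  rw [h, real_inner_comm]

theorem IsRegular.inner_leviCivita_frameAt (hD : D.IsRegular) (v : TangentSpace I x)
    (i : Fin (finrank ℝ (D x))) {w : TangentSpace I x} (hw : w ∈ D.orthogonal x) :
    inner ℝ (leviCivita I M (D.frameAt x i) x v) w
      = inner ℝ (D.secondForm x v (D.basisAt x i)) w := by
  rw [hD.inner_leviCivita_eq (mdifferentiableAt_of_contMDiffAt (hD.contMDiffAt_frameAt x i))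
    (D.frameAt_mem x i) v hw, frameAt_self]

variable (D) in
/-- The value of a quadratic expression in the second fundamental form, `|B^D|² - ¼ |I^D|²`. -/
def secondFormSq (x : M) : ℝ :=
  ∑ i, ∑ j, inner ℝ (D.secondForm x (D.basisAt x i) (D.basisAt x j))
    (D.secondForm x (D.basisAt x j) (D.basisAt x i))

theorem secondFormSq_eq_sum (D : Distribution I M) (x : M) :
    D.secondFormSq x = ∑ i, ∑ a, ∑ j,
      inner ℝ (D.secondForm x (D.basisAt x i) (D.basisAt x j)) (D.orthogonal.basisAt x a)
        * inner ℝ (D.secondForm x (D.basisAt x j) (D.basisAt x i)) (D.orthogonal.basisAt x a) := by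
  refine Finset.sum_congr rfl fun i _ ↦ ?_
  rw [Finset.sum_comm]
  exact Finset.sum_congr rfl fun j _ ↦ inner_eq_sum_basisAt_of_mem (secondForm_mem _ _)

/-- Walczak's formula for the mixed curvature of a distribution. -/
theorem IsRegular.mixedCurvature_eq (hD : D.IsRegular) (x : M) :
    D.mixedCurvature x = D.divergenceAlong D.orthogonal.traceSecondFundamentalForm x
      + D.orthogonal.divergenceAlong D.traceSecondFundamentalForm x
      - D.secondFormSq x - D.orthogonal.secondFormSq x := by
  have hO := hD.orthogonal
  have hdiv := hO.divergenceAlong_trace x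
  rw [orthogonal_orthogonal] at hdiv
  have hinv (i : Fin (finrank ℝ (D x))) (v : TangentSpace I x) {a} :
      inner ℝ (leviCivita I M (D.frameAt x i) x v) (D.orthogonal.basisAt x a)
        = inner ℝ (D.secondForm x v (D.basisAt x i)) (D.orthogonal.basisAt x a) :=
    hD.inner_leviCivita_frameAt v i (D.orthogonal.basisAt_mem x a)
  have hinv' (a : Fin (finrank ℝ (D.orthogonal x))) (v : TangentSpace I x) {i} :
      inner ℝ (leviCivita I M (D.orthogonal.frameAt x a) x v) (D.basisAt x i)
        = inner ℝ (D.orthogonal.secondForm x v (D.orthogonal.basisAt x a)) (D.basisAt x i) :=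
    hO.inner_leviCivita_frameAt v a (by
      rw [orthogonal_orthogonal]
      exact D.basisAt_mem x i)
  have hdual (a : Fin (finrank ℝ (D.orthogonal x))) (i) (v : TangentSpace I x) :
      inner ℝ (D.orthogonal.secondForm x v (D.orthogonal.basisAt x a)) (D.basisAt x i)
        = - inner ℝ (D.secondForm x v (D.basisAt x i)) (D.orthogonal.basisAt x a) := by
    rw [hD.inner_secondForm v _ (D.basisAt_mem x i), neg_neg, real_inner_comm]
  have hmixed (i a) : sectionalCurvature x (D.basisAt x i) (D.orthogonal.basisAt x a)
      = inner ℝ (curvature (D.frameAt x i) (D.orthogonal.frameAt x a) (D.orthogonal.frameAt x a) x)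
        (D.frameAt x i x) := by
    have := sectionalCurvature_eq (hD.contMDiffAt_frameAt x i) (hO.contMDiffAt_frameAt x a)
      (by rw [frameAt_self]; exact (D.orthonormal_basisAt x).1 i)
      (by rw [frameAt_self]; exact (D.orthogonal.orthonormal_basisAt x).1 a)
      (inner_eq_zero_of_mem (D.frameAt_mem x i x) (D.orthogonal.frameAt_mem x a x))
    rw [← this, frameAt_self, frameAt_self]
  set e := D.basisAt x with he
  set f := D.orthogonal.basisAt x with hf
  -- θ and σ depend on the frames: they are the connection coefficients within D along D^⊥ and
  -- within D^⊥ along D. t and s are the components of the two second forms.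
  let θ (a i j) : ℝ := inner ℝ (leviCivita I M (D.frameAt x i) x (f a)) (e j)
  let σ (i a b) : ℝ := inner ℝ (leviCivita I M (D.orthogonal.frameAt x a) x (e i)) (f b)
  let t (a i j) : ℝ := inner ℝ (D.secondForm x (e i) (e j)) (f a)
  let s (i a b) : ℝ := inner ℝ (D.orthogonal.secondForm x (f a) (f b)) (e i)
  have hterm (i a) : sectionalCurvature x (e i) (f a)
      = inner ℝ (leviCivita I M (fun y ↦ (D y).starProjection
          (covDeriv (D.orthogonal.frameAt x a) (D.orthogonal.frameAt x a) y)) x (e i)) (e i)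
        + inner ℝ (leviCivita I M (fun y ↦ (D.orthogonal y).starProjection
            (covDeriv (D.frameAt x i) (D.frameAt x i) y)) x (f a)) (f a)
        - ∑ j, t a i j * t a j i - ∑ b, s i a b * s i b a
        - ∑ j, θ a i j * (t a i j + t a j i) - ∑ b, σ i a b * (s i a b + s i b a) := by
    rw [hmixed, hD.inner_curvature_mixed (hD.contMDiffAt_frameAt x i) (hO.contMDiffAt_frameAt x a)
      (D.frameAt_mem x i) (D.orthogonal.frameAt_mem x a)]
    rw [inner_eq_sum_basisAt D (covDeriv _ _ x) (covDeriv _ _ x),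
      apply_eq_sum_basisAt D _ (covDeriv (D.frameAt x i) _ x),
      apply_eq_sum_basisAt D _ (covDeriv (D.orthogonal.frameAt x a) _ x)]
    simp only [covDeriv, frameAt_self]
    simp only [← he, ← hf]
    simp only [hinv, hinv', mul_add, Finset.sum_add_distrib]
    have h1 (j) : inner ℝ (D.orthogonal.secondForm x (e j) (f a)) (e i) = - t a j i := hdual a i _
    have h1' (j) : inner ℝ (D.orthogonal.secondForm x (e i) (f a)) (e j) = - t a i j := hdual a j _
    have h2 (b) : inner ℝ (D.secondForm x (f a) (e i)) (f b) = - s i a b := by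
      rw [← neg_eq_iff_eq_neg]
      exact (hdual b i _).symm
    have h3 (b) : inner ℝ (D.orthogonal.secondForm x (f b) (f a)) (e i) = s i b a := rfl
    simp only [h1, h1', h2, h3]
    simp only [t, s, θ, σ, neg_mul, mul_neg, Finset.sum_neg_distrib, neg_neg]
    simp only [mul_comm (inner ℝ (leviCivita I M (D.frameAt x i) x (f a)) _)]
    ring
  -- The frame-dependent terms pair a skew matrix with a symmetric one.
  have hθ (a) : ∑ i, ∑ j, θ a i j * (t a i j + t a j i) = 0 :=
    sum_skew_mul_symm fun i j ↦ hD.inner_leviCivita_frameAt_skew _ i j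
  have hσ (i) : ∑ a, ∑ b, σ i a b * (s i a b + s i b a) = 0 :=
    sum_skew_mul_symm fun a b ↦ hO.inner_leviCivita_frameAt_skew _ a b
  have ht : D.secondFormSq x = ∑ i, ∑ a, ∑ j, t a i j * t a j i := D.secondFormSq_eq_sum x
  have hs : D.orthogonal.secondFormSq x = ∑ i, ∑ a, ∑ b, s i a b * s i b a := by
    have := D.orthogonal.secondFormSq_eq_sum x
    rw [orthogonal_orthogonal] at this
    rw [this, Finset.sum_comm]
  have hθ' : ∑ i, ∑ a, ∑ j, θ a i j * (t a i j + t a j i) = 0 := by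
    rw [Finset.sum_comm]
    exact Finset.sum_eq_zero fun a _ ↦ hθ a
  have hσ' : ∑ i, ∑ a, ∑ b, σ i a b * (s i a b + s i b a) = 0 :=
    Finset.sum_eq_zero fun i _ ↦ hσ i
  have hdiv' := hD.divergenceAlong_trace x
  rw [Finset.sum_comm] at hdiv'
  rw [mixedCurvature, hdiv, hdiv', ht, hs]
  simp only [← he, ← hf, hterm, Finset.sum_sub_distrib, Finset.sum_add_distrib, hθ', hσ']
  ring

end Distribution

/-! ### Almost contact algebra and the Sasakian identities -/

namespace AlmostContactMetricStructure

variable (S : AlmostContactMetricStructure I M) {x : M}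

theorem ξ_ne_zero (x : M) : S.ξ x ≠ 0 := fun h ↦ by
  have := S.η_ξ x
  simp [h] at this

/-- Since φ²ξ = 0, also φ²(φξ) = 0, so φξ = cξ. Then c²ξ = φ²ξ = 0 forces c = 0. -/
theorem φ_ξ (x : M) : S.φ x (S.ξ x) = 0 := by
  have h1 : S.φ x (S.φ x (S.ξ x)) = 0 := by simp [S.φ_φ, S.η_ξ]
  obtain ⟨c, hc⟩ : ∃ c : ℝ, S.φ x (S.ξ x) = c • S.ξ x := by
    have h2 := S.φ_φ x (S.φ x (S.ξ x))
    rw [h1, map_zero, eq_comm, neg_add_eq_zero] at h2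
    exact ⟨_, h2⟩
  rw [hc, map_smul, hc, smul_smul] at h1
  have h3 := (smul_eq_zero.1 h1).resolve_right (S.ξ_ne_zero x)
  rw [hc, mul_self_eq_zero.1 h3, zero_smul]

theorem η_φ (v : TangentSpace I x) : S.η x (S.φ x v) = 0 := by
  have h1 := S.φ_φ x (S.φ x v)
  rw [S.φ_φ x v, map_add, map_smul, S.φ_ξ, smul_zero, add_zero, map_neg] at h1
  have h2 : S.η x (S.φ x v) • S.ξ x = 0 := left_eq_add.1 h1
  exact (smul_eq_zero.1 h2).resolve_right (S.ξ_ne_zero x)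

theorem inner_ξ (v : TangentSpace I x) : inner ℝ v (S.ξ x) = S.η x v := by
  have h := S.inner_φ_φ x v (S.ξ x)
  rw [S.φ_ξ, inner_zero_right, S.η_ξ, mul_one] at h
  linarith

theorem inner_φ (v w : TangentSpace I x) :
    inner ℝ (S.φ x v) w = - inner ℝ v (S.φ x w) := by
  have h := S.inner_φ_φ x v (S.φ x w)
  rw [S.φ_φ, S.η_φ, inner_add_right, inner_neg_right, inner_smul_right, inner_ξ, S.η_φ] at h
  linarith

theorem φ_φ_φ (v : TangentSpace I x) : S.φ x (S.φ x (S.φ x v)) = - S.φ x v := by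
  rw [S.φ_φ, S.η_φ, zero_smul, add_zero]

theorem mdifferentiableAt_applyφ {X : Π x : M, TangentSpace I x} (hX : MDiffAt (T% X) x) :
    MDiffAt (T% (S.applyφ X)) x :=
  MDifferentiableAt.clm_bundle_apply (F₁ := E) (F₂ := E) (b := fun y ↦ y)
    (S.smooth_φ.contMDiffAt.mdifferentiableAt (by simp)) hX

theorem mdifferentiableAt_ξ (x : M) : MDiffAt (T% S.ξ) x :=
  mdifferentiableAt_of_contMDiffAt S.smooth_ξ.contMDiffAt

theorem extDerivOneForm_eq {X Y : Π x : M, TangentSpace I x} (hX : MDiffAt (T% X) x)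
    (hY : MDiffAt (T% Y) x) :
    2 * extDerivOneForm S.η X Y x = inner ℝ (leviCivita I M S.ξ x (X x)) (Y x)
      - inner ℝ (leviCivita I M S.ξ x (Y x)) (X x) := by
  have h (X : Π x : M, TangentSpace I x) :
      (fun y ↦ S.η y (X y)) = fun y ↦ inner ℝ (X y) (S.ξ y) := by
    funext y
    rw [inner_ξ]
  rw [extDerivOneForm, h, h, mvfderiv_inner _ hX (S.mdifferentiableAt_ξ x),
    mvfderiv_inner _ hY (S.mdifferentiableAt_ξ x), ← inner_ξ, ← leviCivita_sub_leviCivita hX hY,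
    inner_sub_left, real_inner_comm (X x), real_inner_comm (Y x)]
  ring

/-- The covariant derivative `(∇_u φ) v`. -/
def covDerivφ (x : M) (u v : TangentSpace I x) : TangentSpace I x :=
  leviCivita I M (S.applyφ (extend E v)) x u - S.φ x (leviCivita I M (extend E v) x u)

/-- Differentiating g(φY, Z) = -g(Y, φZ). The right side sees Y only at x, which is how the
tensoriality of ∇φ is obtained next. -/
theorem inner_leviCivita_applyφ {Y Z : Π x : M, TangentSpace I x} (hY : MDiffAt (T% Y) x)
    (hZ : MDiffAt (T% Z) x) (u : TangentSpace I x) :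
    inner ℝ (leviCivita I M (S.applyφ Y) x u - S.φ x (leviCivita I M Y x u)) (Z x)
      = - inner ℝ (Y x) (leviCivita I M (S.applyφ Z) x u - S.φ x (leviCivita I M Z x u)) := by
  have h : (fun y ↦ inner ℝ (S.applyφ Y y) (Z y)) = fun y ↦ - inner ℝ (Y y) (S.applyφ Z y) := by
    funext y
    exact S.inner_φ _ _
  have h1 := mvfderiv_inner u (S.mdifferentiableAt_applyφ hY) hZ
  rw [h, mvfderiv_fun_neg, neg_apply, mvfderiv_inner u hY (S.mdifferentiableAt_applyφ hZ)] at h1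
  have h2 : inner ℝ (S.applyφ Y x) (leviCivita I M Z x u)
    = - inner ℝ (Y x) (S.φ x (leviCivita I M Z x u)) := S.inner_φ _ _
  have h3 : inner ℝ (leviCivita I M Y x u) (S.applyφ Z x)
    = - inner ℝ (S.φ x (leviCivita I M Y x u)) (Z x) := by rw [S.inner_φ, neg_neg]; rfl
  rw [inner_sub_left, inner_sub_right]
  linarith

theorem leviCivita_applyφ_sub {Y : Π x : M, TangentSpace I x} (hY : MDiffAt (T% Y) x)
    (u : TangentSpace I x) :
    leviCivita I M (S.applyφ Y) x u - S.φ x (leviCivita I M Y x u) = S.covDerivφ x u (Y x) := by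
  refine ext_inner_right ℝ fun w ↦ ?_
  have hw := mdifferentiableAt_extend I E w
  have h1 := S.inner_leviCivita_applyφ hY hw u
  have h2 := S.inner_leviCivita_applyφ (mdifferentiableAt_extend I E (Y x)) hw u
  simp only [extend_apply_self] at h1 h2
  rw [h1, covDerivφ, h2]

theorem inner_covDerivφ (u v w : TangentSpace I x) :
    inner ℝ (S.covDerivφ x u v) w = - inner ℝ v (S.covDerivφ x u w) := by
  have h := S.inner_leviCivita_applyφ (mdifferentiableAt_extend I E v)
    (mdifferentiableAt_extend I E w) u
  simp only [extend_apply_self] at h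
  exact h

theorem covDerivφ_ξ (u : TangentSpace I x) :
    S.covDerivφ x u (S.ξ x) = - S.φ x (leviCivita I M S.ξ x u) := by
  have h : S.applyφ S.ξ = 0 := by
    funext y
    exact S.φ_ξ y
  rw [← S.leviCivita_applyφ_sub (S.mdifferentiableAt_ξ x), h, CovariantDerivative.zero]
  simp

theorem inner_leviCivita_ξ_ξ (u : TangentSpace I x) :
    inner ℝ (leviCivita I M S.ξ x u) (S.ξ x) = 0 := by
  have h := inner_leviCivita_of_const (c := 1) (S.mdifferentiableAt_ξ x) (S.mdifferentiableAt_ξ x)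
    (Filter.Eventually.of_forall fun y ↦ by rw [inner_ξ, S.η_ξ]) u
  rw [real_inner_comm (leviCivita I M S.ξ x u)] at h
  linarith

/-- The derivative of φ² = -I + η ⊗ ξ, with η = g(·, ξ). -/
theorem covDerivφ_φ (u v : TangentSpace I x) :
    S.covDerivφ x u (S.φ x v) + S.φ x (S.covDerivφ x u v)
      = inner ℝ (leviCivita I M S.ξ x u) v • S.ξ x + S.η x v • leviCivita I M S.ξ x u := by
  let Y : Π y : M, TangentSpace I y := extend E v
  have hY : MDiffAt (T% Y) x := mdifferentiableAt_extend I E v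
  have hYv : Y x = v := extend_apply_self _ _
  have hξ := S.mdifferentiableAt_ξ x
  have h1 := S.leviCivita_applyφ_sub (S.mdifferentiableAt_applyφ hY) u
  have h2 := S.leviCivita_applyφ_sub hY u
  have h3 : S.applyφ (S.applyφ Y) = (fun y ↦ inner ℝ (Y y) (S.ξ y)) • S.ξ - Y := by
    funext y
    simp only [applyφ, S.φ_φ, Pi.sub_apply, Pi.smul_apply', inner_ξ]
    abel
  have hf := mdifferentiableAt_inner hY hξ
  rw [h3, leviCivita_sub (hf.smul_section hξ) hY,
    (leviCivita I M).isCovariantDerivativeOnUniv.leibniz hξ hf] at h1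
  have h4 : S.applyφ Y x = S.φ x v := by rw [← hYv]; rfl
  rw [h4] at h1
  rw [hYv] at h2
  rw [← h1, ← h2]
  simp only [sub_apply, add_apply, smul_apply, ContinuousLinearMap.smulRight_apply,
    mvfderiv_inner u hY hξ, map_sub, S.φ_φ]
  simp only [inner_ξ, hYv, real_inner_comm v, add_smul]
  abel

variable {S} {n : ℕ}

theorem IsContactMetric.inner_leviCivita_ξ (hS : S.IsContactMetric n) (v w : TangentSpace I x) :
    inner ℝ (leviCivita I M S.ξ x v) w - inner ℝ (leviCivita I M S.ξ x w) v
      = 2 * inner ℝ v (S.φ x w) := by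
  have h1 := hS.associated x (extend E v) (extend E w) (contMDiffAt_extend I E v)
    (contMDiffAt_extend I E w)
  have h2 := S.extDerivOneForm_eq (mdifferentiableAt_extend I E v) (mdifferentiableAt_extend I E w)
  rw [h1] at h2
  simp only [extend_apply_self] at h2
  exact h2.symm

/-- The fundamental form `Φ(X, Y) = g(X, φY) = dη(X, Y)` is closed. -/
theorem IsContactMetric.covDerivφ_cyclic (hS : S.IsContactMetric n) (u v w : TangentSpace I x) :
    inner ℝ (S.covDerivφ x u v) w + inner ℝ (S.covDerivφ x v w) u
      + inner ℝ (S.covDerivφ x w u) v = 0 := by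
  have hξ : CMDiffAt ∞ (T% S.ξ) x := S.smooth_ξ.contMDiffAt
  -- This differentiates 2g(Z, φY) = g(∇_Z ξ, Y) - g(∇_Y ξ, Z) along X. In the cyclic sum the second
  -- derivatives of ξ combine to curvature terms g(ξ, R(X, Y)Z), which cancel by Bianchi: d(dη) = 0
  -- in terms of ∇.
  have key {X Y Z : Π x : M, TangentSpace I x} (hX : CMDiffAt ∞ (T% X) x)
      (hY : CMDiffAt ∞ (T% Y) x) (hZ : CMDiffAt ∞ (T% Z) x) :
      2 * inner ℝ (S.covDerivφ x (X x) (Y x)) (Z x)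
        = inner ℝ (covDeriv X (covDeriv Z S.ξ) x) (Y x)
          - inner ℝ (covDeriv X (covDeriv Y S.ξ) x) (Z x)
          - inner ℝ (leviCivita I M S.ξ x (covDeriv X Z x)) (Y x)
          + inner ℝ (leviCivita I M S.ξ x (covDeriv X Y x)) (Z x) := by
    have hY' := mdifferentiableAt_of_contMDiffAt hY
    have hZ' := mdifferentiableAt_of_contMDiffAt hZ
    have hZξ := mdifferentiableAt_of_contMDiffAt (contMDiffAt_covDeriv hZ hξ)
    have hYξ := mdifferentiableAt_of_contMDiffAt (contMDiffAt_covDeriv hY hξ)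
    have e : (fun y ↦ 2 * inner ℝ (Z y) (S.applyφ Y y)) = fun y ↦
        inner ℝ (covDeriv Z S.ξ y) (Y y) - inner ℝ (covDeriv Y S.ξ y) (Z y) := by
      funext y
      exact (hS.inner_leviCivita_ξ _ _).symm
    have d1 := mvfderiv_inner (X x) hZ' (S.mdifferentiableAt_applyφ hY')
    have d2 : mvfderiv I (fun y ↦ 2 * inner ℝ (Z y) (S.applyφ Y y)) x (X x)
        = 2 * mvfderiv I (fun y ↦ inner ℝ (Z y) (S.applyφ Y y)) x (X x) := by
      rw [mvfderiv_fun_mul mdifferentiableAt_const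
        (mdifferentiableAt_inner hZ' (S.mdifferentiableAt_applyφ hY')), mvfderiv_const]
      simp
    rw [e, mvfderiv_fun_sub (mdifferentiableAt_inner hZξ hY') (mdifferentiableAt_inner hYξ hZ'),
      sub_apply, mvfderiv_inner _ hZξ hY', mvfderiv_inner _ hYξ hZ', d1] at d2
    have d3 := hS.inner_leviCivita_ξ (covDeriv X Z x) (Y x)
    have d4 := hS.inner_leviCivita_ξ (Z x) (covDeriv X Y x)
    rw [← S.leviCivita_applyφ_sub hY', inner_sub_left, real_inner_comm _ (leviCivita I M _ x _),
      real_inner_comm _ (S.φ x _)]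
    simp only [covDeriv, applyφ] at d2 d3 d4 ⊢
    linarith
  let X : Π y : M, TangentSpace I y := extend E u
  let Y : Π y : M, TangentSpace I y := extend E v
  let Z : Π y : M, TangentSpace I y := extend E w
  have hX : CMDiffAt ∞ (T% X) x := contMDiffAt_extend I E u
  have hY : CMDiffAt ∞ (T% Y) x := contMDiffAt_extend I E v
  have hZ : CMDiffAt ∞ (T% Z) x := contMDiffAt_extend I E w
  have hXu : X x = u := extend_apply_self _ _
  have hYv : Y x = v := extend_apply_self _ _
  have hZw : Z x = w := extend_apply_self _ _
  have k1 := key hX hY hZ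
  have k2 := key hY hZ hX
  have k3 := key hZ hX hY
  have r {X Y Z : Π x : M, TangentSpace I x} (hX : CMDiffAt ∞ (T% X) x)
      (hY : CMDiffAt ∞ (T% Y) x) (hZ : CMDiffAt ∞ (T% Z) x) :
      inner ℝ (S.ξ x) (curvature X Y Z x)
        = - (inner ℝ (covDeriv X (covDeriv Y S.ξ) x) (Z x)
          - inner ℝ (covDeriv Y (covDeriv X S.ξ) x) (Z x)
          - (inner ℝ (leviCivita I M S.ξ x (covDeriv X Y x)) (Z x)
            - inner ℝ (leviCivita I M S.ξ x (covDeriv Y X x)) (Z x))) := by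
    rw [← neg_eq_iff_eq_neg, ← inner_curvature_skew hX hY hξ hZ, curvature,
      ← leviCivita_sub_leviCivita (mdifferentiableAt_of_contMDiffAt hX)
        (mdifferentiableAt_of_contMDiffAt hY), map_sub]
    simp only [inner_sub_left]
  have r1 := r hX hY hZ
  have r2 := r hY hZ hX
  have r3 := r hZ hX hY
  have b := congrArg (inner ℝ (S.ξ x)) (curvature_bianchi hX hY hZ)
  rw [inner_add_right, inner_add_right, inner_zero_right] at b
  simp only [hXu, hYv, hZw] at k1 k2 k3 r1 r2 r3
  linarith

/-- Writing the brackets in [φ, φ] through the torsion-free ∇, all derivatives of the fields cancel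
and only ∇φ survives. -/
theorem IsSasakian.covDerivφ_normal (hS : S.IsSasakian n) (u v : TangentSpace I x) :
    S.covDerivφ x (S.φ x u) v - S.covDerivφ x (S.φ x v) u - S.φ x (S.covDerivφ x u v)
      + S.φ x (S.covDerivφ x v u) + (2 * inner ℝ u (S.φ x v)) • S.ξ x = 0 := by
  let X : Π y : M, TangentSpace I y := extend E u
  let Y : Π y : M, TangentSpace I y := extend E v
  have hX : CMDiffAt ∞ (T% X) x := contMDiffAt_extend I E u
  have hY : CMDiffAt ∞ (T% Y) x := contMDiffAt_extend I E v
  have hXu : X x = u := extend_apply_self _ _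
  have hYv : Y x = v := extend_apply_self _ _
  have h := hS.isNormal x X Y hX hY
  have hX' := mdifferentiableAt_of_contMDiffAt hX
  have hY' := mdifferentiableAt_of_contMDiffAt hY
  have hφX := S.mdifferentiableAt_applyφ hX'
  have hφY := S.mdifferentiableAt_applyφ hY'
  rw [hS.isContactMetric.associated x X Y hX hY, nijenhuis, ← leviCivita_sub_leviCivita hX' hY',
    ← leviCivita_sub_leviCivita hφX hφY, ← leviCivita_sub_leviCivita hφX hY',
    ← leviCivita_sub_leviCivita hX' hφY] at h
  have c1 : leviCivita I M (S.applyφ Y) x (S.φ x u)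
      = S.covDerivφ x (S.φ x u) v + S.φ x (leviCivita I M Y x (S.φ x u)) := by
    rw [← sub_eq_iff_eq_add, S.leviCivita_applyφ_sub hY', hYv]
  have c2 : leviCivita I M (S.applyφ X) x (S.φ x v)
      = S.covDerivφ x (S.φ x v) u + S.φ x (leviCivita I M X x (S.φ x v)) := by
    rw [← sub_eq_iff_eq_add, S.leviCivita_applyφ_sub hX', hXu]
  have c3 : leviCivita I M (S.applyφ X) x v
      = S.covDerivφ x v u + S.φ x (leviCivita I M X x v) := by
    rw [← sub_eq_iff_eq_add, S.leviCivita_applyφ_sub hX', hXu]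
  have c4 : leviCivita I M (S.applyφ Y) x u
      = S.covDerivφ x u v + S.φ x (leviCivita I M Y x u) := by
    rw [← sub_eq_iff_eq_add, S.leviCivita_applyφ_sub hY', hYv]
  have aX : S.applyφ X x = S.φ x u := by rw [← hXu]; rfl
  have aY : S.applyφ Y x = S.φ x v := by rw [← hYv]; rfl
  rw [aX, aY, hXu, hYv, c1, c2, c3, c4] at h
  rw [← h]
  simp only [map_sub, map_add]
  abel

/-- On a Sasakian manifold, `∇_u ξ = -φu`. -/
theorem IsSasakian.leviCivita_ξ (hS : S.IsSasakian n) (u : TangentSpace I x) :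
    leviCivita I M S.ξ x u = - S.φ x u := by
  have hL := hS.isContactMetric.inner_leviCivita_ξ (x := x)
  set a := leviCivita I M S.ξ x with ha
  have hηa (u) : S.η x (a u) = 0 := by rw [← inner_ξ]; exact S.inner_leviCivita_ξ_ξ u
  have hφφa (u) : S.φ x (S.φ x (a u)) = - a u := by rw [S.φ_φ, hηa, zero_smul, add_zero]
  have haξ : a (S.ξ x) = 0 := by
    refine ext_inner_right ℝ fun w ↦ ?_
    have h := hL (S.ξ x) w
    rw [inner_ξ, hηa, real_inner_comm (S.φ x w) (S.ξ x), inner_ξ, S.η_φ] at h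
    rw [inner_zero_left]
    linarith
  -- With a = ∇ξ, closedness of the fundamental form with ξ in one slot determines ∇_ξ φ in terms of
  -- a. Normality with ξ in one slot then gives φaφ = φ. Applying φ and using φ²a = -a yields aφ =
  -- -φ², and evaluating on φu gives a = -φ, because aξ = 0.
  have h1 (v) : S.covDerivφ x (S.ξ x) v
      = - S.φ x (a v) - a (S.φ x v) - (2 : ℝ) • S.φ x (S.φ x v) := by
    refine ext_inner_right ℝ fun w ↦ ?_
    have h := hS.isContactMetric.covDerivφ_cyclic (S.ξ x) v w
    have h2 := hL (S.φ x v) w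
    have h3 := S.inner_φ (S.φ x v) w
    rw [S.inner_covDerivφ v w, S.covDerivφ_ξ, S.covDerivφ_ξ, inner_neg_right, inner_neg_left,
      S.inner_φ (leviCivita I M S.ξ x w) v, real_inner_comm _ w] at h
    simp only [inner_sub_left, inner_neg_left, inner_smul_left, RCLike.conj_to_real, h3]
    simp only [← ha] at h
    linarith
  have h2 (u) : S.φ x (a (S.φ x u)) = S.φ x u := by
    have h := hS.covDerivφ_normal u (S.ξ x)
    have h0 : S.covDerivφ x (S.φ x (S.ξ x)) u = 0 := by
      rw [S.φ_ξ]
      simp [covDerivφ]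
    rw [h0, S.φ_ξ, S.covDerivφ_ξ, S.covDerivφ_ξ, h1, inner_zero_right, mul_zero, zero_smul] at h
    simp only [map_sub, map_neg, map_smul, ← ha, hφφa, S.φ_φ_φ] at h
    have h' : (2 : ℝ) • (S.φ x u - S.φ x (a (S.φ x u))) = 0 := by
      rw [← h, smul_sub, two_smul, two_smul]
      module
    exact (sub_eq_zero.1 ((smul_eq_zero.1 h').resolve_left two_ne_zero)).symm
  have h3 (u) : a (S.φ x u) = - S.φ x (S.φ x u) := by
    rw [← neg_eq_iff_eq_neg, ← hφφa, h2]
  have h4 := h3 (S.φ x u)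
  rw [S.φ_φ_φ, neg_neg, S.φ_φ, map_add, map_smul, haξ, smul_zero, add_zero, map_neg] at h4
  rw [← h4, neg_neg]

/-- On a Sasakian manifold, `(∇_u φ)v = g(u, v)ξ - η(v)u`. -/
theorem IsSasakian.covDerivφ_eq (hS : S.IsSasakian n) (u v : TangentSpace I x) :
    S.covDerivφ x u v = inner ℝ u v • S.ξ x - S.η x v • u := by
  -- T is the defect from the claimed formula. The expected tensor satisfies the same skewness,
  -- φ-anticommutation, cyclic and normality relations as ∇φ, so T satisfies their homogeneous
  -- versions, and these force T = 0.
  let T (u v : TangentSpace I x) : TangentSpace I x :=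
    S.covDerivφ x u v - inner ℝ u v • S.ξ x + S.η x v • u
  have hηξ (v : TangentSpace I x) : inner ℝ (S.ξ x) v = S.η x v := by
    rw [real_inner_comm, inner_ξ]
  have skew (u v w) : inner ℝ (T u v) w = - inner ℝ (T u w) v := by
    simp only [T, inner_sub_left, inner_add_left, inner_smul_left, RCLike.conj_to_real, hηξ,
      S.inner_covDerivφ u v w, real_inner_comm _ v]
    ring
  have cyc (u v w) : inner ℝ (T u v) w + inner ℝ (T v w) u + inner ℝ (T w u) v = 0 := by
    have := hS.isContactMetric.covDerivφ_cyclic u v w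
    simp only [T, inner_sub_left, inner_add_left, inner_smul_left, RCLike.conj_to_real, hηξ,
      real_inner_comm u v, real_inner_comm u w, real_inner_comm v w]
    linarith
  have hφ (u v w) : inner ℝ (T u (S.φ x v)) w = inner ℝ (T u v) (S.φ x w) := by
    have h : T u (S.φ x v) + S.φ x (T u v) = 0 := by
      have h1 := S.covDerivφ_φ u v
      rw [hS.leviCivita_ξ] at h1
      simp only [T, map_sub, map_add, map_smul, S.φ_ξ, S.η_φ]
      have h2 : inner ℝ u (S.φ x v) = - inner ℝ (S.φ x u) v := by rw [S.inner_φ, neg_neg]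
      rw [h2]
      calc _ = (S.covDerivφ x u (S.φ x v) + S.φ x (S.covDerivφ x u v))
            + inner ℝ (S.φ x u) v • S.ξ x + S.η x v • S.φ x u := by module
        _ = 0 := by
            rw [h1, inner_neg_left]
            module
    have h' := congrArg (fun z ↦ inner ℝ z w) h
    simp only [inner_add_left, inner_zero_left, S.inner_φ] at h'
    linarith
  have nrm (u v w) : inner ℝ (T (S.φ x u) v) w - inner ℝ (T (S.φ x v) u) w
      + inner ℝ (T u v) (S.φ x w) - inner ℝ (T v u) (S.φ x w) = 0 := by
    have h := congrArg (fun z ↦ inner ℝ z w) (hS.covDerivφ_normal u v)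
    simp only [inner_add_left, inner_sub_left, inner_zero_left, S.inner_φ, inner_smul_left,
      RCLike.conj_to_real, hηξ] at h
    have e1 := S.inner_φ u v
    have e2 := S.inner_φ v u
    have e3 := real_inner_comm u (S.φ x v)
    have e4 := S.inner_φ u w
    have e5 := S.inner_φ v w
    simp only [T, inner_sub_left, inner_add_left, inner_smul_left, RCLike.conj_to_real, hηξ, S.η_φ]
    rw [e4, e5, e1, e3]
    linarith
  -- Two cyclic identities, substituted into normality, cancel everything but -2g(T(w, φu), v).
  have hzero (w u v) : inner ℝ (T w (S.φ x u)) v = 0 := by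
    have n1 := nrm u v w
    have c1 := cyc (S.φ x u) v w
    have c2 := cyc u (S.φ x v) w
    have s1 := skew v w (S.φ x u)
    have s2 := skew (S.φ x v) w u
    have f1 := hφ u v w
    have f2 := hφ v u w
    have f3 := hφ w u v
    linarith
  have hTξ (w) : T w (S.ξ x) = 0 := by
    simp only [T, S.covDerivφ_ξ, hS.leviCivita_ξ, inner_ξ, S.η_ξ, map_neg, S.φ_φ]
    module
  have hT : T u v = 0 := by
    refine ext_inner_right ℝ fun w ↦ ?_
    have hv : v = S.η x v • S.ξ x - S.φ x (S.φ x v) := by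
      rw [S.φ_φ]
      abel
    rw [skew, hv, inner_sub_right, inner_smul_right, skew u w (S.ξ x), hTξ,
      skew u w (S.φ x _), hzero]
    simp
  have hT' : S.covDerivφ x u v - (inner ℝ u v • S.ξ x - S.η x v • u) = 0 := by
    rw [← hT]
    simp only [T]
    abel
  exact sub_eq_zero.1 hT'

theorem IsSasakian.leviCivita_applyφ (hS : S.IsSasakian n) {Y : Π x : M, TangentSpace I x}
    (hY : MDiffAt (T% Y) x) (u : TangentSpace I x) :
    leviCivita I M (S.applyφ Y) x u
      = S.φ x (leviCivita I M Y x u) + inner ℝ u (Y x) • S.ξ x - S.η x (Y x) • u := by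
  have h := S.leviCivita_applyφ_sub hY u
  rw [hS.covDerivφ_eq, sub_eq_iff_eq_add] at h
  rw [h]
  abel

end AlmostContactMetricStructure

/-! ### Bilinearity of the second form, and integrable distributions -/

namespace Distribution

variable {D : Distribution I M} {x : M}

theorem IsRegular.inner_secondForm_starProjection (hD : D.IsRegular) (u v w : TangentSpace I x) :
    inner ℝ (D.secondForm x u v) w
      = - inner ℝ ((D x).starProjection v) (D.orthogonal.secondForm x u w) := by
  rw [secondForm, hD.inner_starProjection_leviCivita
      (mdifferentiableAt_of_contMDiffAt (hD.contMDiffAt_extendSection _))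
      (fun y ↦ extendSection_mem _ y), extendSection_self]
  simp only [secondForm, orthogonal_orthogonal]
  rw [← inner_starProjection_left,
    Submodule.starProjection_eq_self_iff.2 (Submodule.starProjection_apply_mem (D x) v)]

/-- The second form of `D` as a bilinear map. -/
def IsRegular.secondFormₗ (hD : D.IsRegular) (x : M) :
    TangentSpace I x →ₗ[ℝ] TangentSpace I x →ₗ[ℝ] TangentSpace I x :=
  LinearMap.mk₂ ℝ (D.secondForm x)
    (fun u u' v ↦ by simp only [secondForm, map_add])
    (fun c u v ↦ by simp only [secondForm, map_smul])
    (fun u v v' ↦ ext_inner_right ℝ fun w ↦ by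
      simp only [inner_add_left, hD.inner_secondForm_starProjection, map_add, neg_add])
    (fun c u v ↦ ext_inner_right ℝ fun w ↦ by
      simp only [inner_smul_left, hD.inner_secondForm_starProjection, map_smul, mul_neg])

theorem IsRegular.secondFormₗ_apply (hD : D.IsRegular) (u v : TangentSpace I x) :
    hD.secondFormₗ x u v = D.secondForm x u v := rfl

/-- A vector field tangent to the fibres of a map is annihilated by its differential, and hence
so is the bracket of two such fields. -/
theorem IsIntegrable.integrabilityTensor_eq_zero (hD : D.IsIntegrable)
    {X Y : Π x : M, TangentSpace I x} (hX : CMDiffAt ∞ (T% X) x) (hY : CMDiffAt ∞ (T% Y) x)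
    (hXD : ∀ y, X y ∈ D y) (hYD : ∀ y, Y y ∈ D y) : D.integrabilityTensor X Y x = 0 := by
  obtain ⟨U, q, f, hU, hx, hf, hker⟩ := hD x
  have hfU {y} (hy : y ∈ U) : CMDiffAt ∞ f y := hf.contMDiffAt (hU.mem_nhds hy)
  -- The commutator formula for brackets concerns real functions, so it is applied to each component
  -- of the submersion.
  have hcomp (j : Fin q) {y} (hy : y ∈ U) (v : TangentSpace I y) :
      mvfderiv I (fun z ↦ f z j) y v = (mvfderiv I f y v : EuclideanSpace ℝ (Fin q)) j := by
    have h := mvfderiv_comp_apply (I' := I) (I := 𝓘(ℝ, EuclideanSpace ℝ (Fin q))) (f := f)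
      (g := (EuclideanSpace.proj j : EuclideanSpace ℝ (Fin q) →L[ℝ] ℝ)) y
      (ContinuousLinearMap.mdifferentiableAt _) ((hfU hy).mdifferentiableAt (by simp)) v
    refine h.trans ?_
    simp only [mvfderiv]
    rw [ContinuousLinearMap.mfderiv_eq]
    rfl
  have hj (j : Fin q) : mvfderiv I (fun z ↦ f z j) x (mlieBracket I X Y x) = 0 := by
    have hfj : CMDiffAt ∞ (fun z ↦ f z j) x :=
      (EuclideanSpace.proj j : EuclideanSpace ℝ (Fin q) →L[ℝ] ℝ).contMDiff.contMDiffAt.comp x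
        (hfU hx)
    have hz {Z : Π x : M, TangentSpace I x} (hZ : ∀ y, Z y ∈ D y) :
        mvfderiv I (fun y ↦ mvfderiv I (fun z ↦ f z j) y (Z y)) x = 0 := by
      refine mvfderiv_eq_zero_of_eventually_const (c := 0) ?_
      filter_upwards [hU.mem_nhds hx] with y hy
      rw [hcomp j hy, ((hker y hy).2 _).1 (hZ y)]
      rfl
    rw [mvfderiv_mlieBracket hfj hX hY, hz hXD, hz hYD]
    simp
  have hmem : mlieBracket I X Y x ∈ D x := by
    rw [(hker x hx).2]
    ext j
    rw [← hcomp j hx, hj]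
    rfl
  rw [integrabilityTensor]
  exact Submodule.starProjection_orthogonal_apply_eq_zero hmem

theorem IsIntegrable.normSqIntegrabilityTensor_eq_zero (hD : D.IsIntegrable) (hD' : D.IsRegular)
    (x : M) : D.normSqIntegrabilityTensor x = 0 := by
  refine Finset.sum_eq_zero fun i _ ↦ Finset.sum_eq_zero fun j _ ↦ ?_
  rw [hD.integrabilityTensor_eq_zero (hD'.contMDiffAt_sectionAt x i)
    (hD'.contMDiffAt_sectionAt x j) (D.sectionAt_mem x i) (D.sectionAt_mem x j)]
  simp

end Distribution

/-! ### Invariant and contact-holomorphic distributions -/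

namespace AlmostContactMetricStructure

variable {S : AlmostContactMetricStructure I M} {V : Distribution I M} {x : M} {n : ℕ}

/-- An invariant distribution of odd rank contains the characteristic vector field. -/
theorem IsInvariant.ξ_mem (hV : S.IsInvariant V) (hodd : Odd (finrank ℝ (V x))) :
    S.ξ x ∈ V x := by
  by_contra hξ
  -- Invariance puts η(v)ξ = φ²v + v in V. So if ξ ∉ V, then η vanishes on V and φ² = -1 there,
  -- which would give det(φ|V)² = -1 in odd dimension.
  have hη (v : TangentSpace I x) (hv : v ∈ V x) : S.η x v = 0 := by
    by_contra h
    have h1 : S.η x v • S.ξ x ∈ V x := by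
      have : S.η x v • S.ξ x = S.φ x (S.φ x v) + v := by rw [S.φ_φ]; abel
      rw [this]
      exact (V x).add_mem (hV x _ (hV x _ hv)) hv
    exact hξ (((V x).smul_mem_iff h).1 h1)
  let f : V x →ₗ[ℝ] V x := (S.φ x).toLinearMap.restrict (hV x)
  have hf : f * f = (-1 : ℝ) • LinearMap.id := by
    ext v
    change S.φ x (S.φ x v) = (-1 : ℝ) • (v : TangentSpace I x)
    rw [S.φ_φ, hη _ v.2]
    simp
  have hdet := congrArg LinearMap.det hf
  rw [map_mul, LinearMap.det_smul, LinearMap.det_id, hodd.neg_one_pow, mul_one] at hdet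
  nlinarith [mul_self_nonneg (LinearMap.det f)]

theorem IsInvariant.orthogonal (hV : S.IsInvariant V) : S.IsInvariant V.orthogonal := by
  intro x v hv
  refine (Submodule.mem_orthogonal _ _).2 fun u hu ↦ ?_
  have h := S.inner_φ u v
  rw [Distribution.inner_eq_zero_of_mem (hV x u hu) hv] at h
  linarith

theorem IsInvariant.starProjection_φ (hV : S.IsInvariant V) (v : TangentSpace I x) :
    (V.orthogonal x).starProjection (S.φ x v)
      = S.φ x ((V.orthogonal x).starProjection v) := by
  conv_lhs => rw [← V.starProjection_add_starProjection_orthogonal v, map_add, map_add]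
  rw [Submodule.starProjection_eq_self_iff.2
      (hV.orthogonal x _ (Submodule.starProjection_apply_mem _ _)),
    show (V.orthogonal x).starProjection (S.φ x ((V x).starProjection v)) = 0 from
      Submodule.starProjection_orthogonal_apply_eq_zero
        (hV x _ (Submodule.starProjection_apply_mem _ _)), zero_add]

theorem η_eq_zero (hξ : S.ξ x ∈ V x) {v : TangentSpace I x} (hv : v ∈ V.orthogonal x) :
    S.η x v = 0 := by
  rw [← S.inner_ξ]
  exact Distribution.inner_eq_zero_of_mem' hξ hv

theorem φ_φ_of_mem_orthogonal (hξ : S.ξ x ∈ V x) {v : TangentSpace I x}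
    (hv : v ∈ V.orthogonal x) : S.φ x (S.φ x v) = - v := by
  rw [S.φ_φ, η_eq_zero hξ hv, zero_smul, add_zero]

theorem sum_η_smul_basisAt (hξ : S.ξ x ∈ V x) :
    ∑ i, S.η x (V.basisAt x i) • V.basisAt x i = S.ξ x := by
  have h := V.sum_inner_basisAt_smul x (S.ξ x)
  rw [Submodule.starProjection_eq_self_iff.2 hξ] at h
  simpa only [S.inner_ξ] using h

theorem sum_η_basisAt_sq (hξ : S.ξ x ∈ V x) : ∑ i, S.η x (V.basisAt x i) ^ 2 = 1 := by
  rw [← S.η_ξ x]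
  conv_rhs => rw [← sum_η_smul_basisAt hξ, map_sum]
  simp [sq]

/-- The trace over an invariant distribution of a bilinear map composed with `φ × φ`. -/
theorem IsInvariant.sum_apply_φ_φ {W : Type*} [AddCommGroup W] [Module ℝ W]
    (hV : S.IsInvariant V) (hξ : S.ξ x ∈ V x)
    (B : TangentSpace I x →ₗ[ℝ] TangentSpace I x →ₗ[ℝ] W) :
    ∑ i, B (S.φ x (V.basisAt x i)) (S.φ x (V.basisAt x i))
      = ∑ i, B (V.basisAt x i) (V.basisAt x i) - B (S.ξ x) (S.ξ x) := by
  have hφ i : S.φ x (V.basisAt x i)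
      = ∑ j, inner ℝ (V.basisAt x j) (S.φ x (V.basisAt x i)) • V.basisAt x j := by
    rw [V.sum_inner_basisAt_smul, Submodule.starProjection_eq_self_iff.2 (hV x _ (V.basisAt_mem x i))]
  -- Since φ is skew and preserves V, this sum is g(φe_j, φe_k): the matrix P of φ on V satisfies P
  -- Pᵀ = 1 - η ηᵀ.
  have hsum j k : ∑ i, inner ℝ (V.basisAt x j) (S.φ x (V.basisAt x i))
      * inner ℝ (V.basisAt x k) (S.φ x (V.basisAt x i))
      = (if j = k then 1 else 0) - S.η x (V.basisAt x j) * S.η x (V.basisAt x k) := by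
    rw [← orthonormal_iff_ite.1 (V.orthonormal_basisAt x) j k, ← S.inner_φ_φ,
      Distribution.inner_eq_sum_basisAt_of_mem (hV x _ (V.basisAt_mem x k))]
    refine Finset.sum_congr rfl fun i _ ↦ ?_
    rw [S.inner_φ, S.inner_φ, neg_mul_neg]
  calc ∑ i, B (S.φ x (V.basisAt x i)) (S.φ x (V.basisAt x i))
      = ∑ i, ∑ j, ∑ k, (inner ℝ (V.basisAt x j) (S.φ x (V.basisAt x i))
          * inner ℝ (V.basisAt x k) (S.φ x (V.basisAt x i)))
            • B (V.basisAt x j) (V.basisAt x k) := by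
        refine Finset.sum_congr rfl fun i _ ↦ ?_
        conv_lhs => rw [hφ i]
        simp only [map_sum, map_smul, LinearMap.sum_apply, LinearMap.smul_apply, Finset.smul_sum,
          smul_smul]
        rw [Finset.sum_comm]
        refine Finset.sum_congr rfl fun j _ ↦ Finset.sum_congr rfl fun k _ ↦ ?_
        rw [mul_comm]
    _ = ∑ j, ∑ k, ((if j = k then 1 else 0) - S.η x (V.basisAt x j) * S.η x (V.basisAt x k))
            • B (V.basisAt x j) (V.basisAt x k) := by
        rw [Finset.sum_comm]
        refine Finset.sum_congr rfl fun j _ ↦ ?_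
        rw [Finset.sum_comm]
        refine Finset.sum_congr rfl fun k _ ↦ ?_
        rw [← Finset.sum_smul, hsum]
    _ = _ := by
        conv_rhs => rw [← sum_η_smul_basisAt hξ]
        simp only [sub_smul, Finset.sum_sub_distrib, ite_smul, one_smul, zero_smul,
          Finset.sum_ite_eq, Finset.mem_univ, if_true, map_sum, map_smul, LinearMap.sum_apply,
          LinearMap.smul_apply, Finset.smul_sum, smul_smul]
        congr 1
        rw [Finset.sum_comm]
        refine Finset.sum_congr rfl fun j _ ↦ Finset.sum_congr rfl fun k _ ↦ ?_
        rw [mul_comm]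

theorem IsSasakian.secondForm_ξ (hS : S.IsSasakian n) (hV : V.IsRegular) (hinv : S.IsInvariant V)
    (hξ : ∀ x, S.ξ x ∈ V x) (u : TangentSpace I x) :
    V.secondForm x u (S.ξ x) = - S.φ x ((V.orthogonal x).starProjection u) := by
  rw [← hV.starProjection_leviCivita (S.mdifferentiableAt_ξ x) hξ, hS.leviCivita_ξ, map_neg,
    hinv.starProjection_φ]

/-- The normal part of ∇_u(φY) = φ∇_u Y + g(u, Y)ξ - η(Y)u. The ξ-term drops out because ξ lies in
V. -/
theorem IsSasakian.secondForm_φ_right (hS : S.IsSasakian n) (hV : V.IsRegular)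
    (hinv : S.IsInvariant V) (hξ : ∀ x, S.ξ x ∈ V x) (u : TangentSpace I x)
    {v : TangentSpace I x} (hv : v ∈ V x) :
    V.secondForm x u (S.φ x v)
      = S.φ x (V.secondForm x u v) - S.η x v • (V.orthogonal x).starProjection u := by
  let Y := V.extendSection x v
  have hY : MDiffAt (T% Y) x := mdifferentiableAt_of_contMDiffAt (hV.contMDiffAt_extendSection v)
  have hYV (y : M) : Y y ∈ V y := Distribution.extendSection_mem v y
  have hYv : Y x = v := by
    rw [← Submodule.starProjection_eq_self_iff.2 hv]
    exact Distribution.extendSection_self v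
  have h := hV.starProjection_leviCivita (S.mdifferentiableAt_applyφ hY)
    (fun y ↦ hinv y _ (hYV y)) u
  have hξ0 : (V.orthogonal x).starProjection (S.ξ x) = 0 :=
    Submodule.starProjection_orthogonal_apply_eq_zero (hξ x)
  rw [hS.leviCivita_applyφ hY, map_sub, map_add, map_smul, map_smul, hξ0, smul_zero, add_zero,
    hinv.starProjection_φ, hV.starProjection_leviCivita hY hYV, hYv] at h
  rw [h, ← hYv]
  rfl

/-- For a contact-holomorphic X in V the normal part of [X, φY] - φ[X, Y] vanishes, being that of a
multiple of ξ. In terms of ∇ this normal part is φ h(Y, X) - h(φY, X), as the Sasakian formula for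
∇φ contributes only multiples of ξ and X. Linearity in v extends the identity from the frame to V.
-/
theorem IsSasakian.secondForm_φ_left (hS : S.IsSasakian n) (hV : V.IsRegular)
    (hinv : S.IsInvariant V) (hξ : ∀ x, S.ξ x ∈ V x) {k : ℕ} (hhol : S.IsContactHolomorphic V k)
    (u : TangentSpace I x) {v : TangentSpace I x} (hv : v ∈ V x) :
    V.secondForm x (S.φ x u) v = S.φ x (V.secondForm x u v) := by
  obtain ⟨U, e, hU, hx, he, hhe⟩ := hhol x
  rw [← he.span_eq x hx] at hv
  let K : Submodule ℝ (TangentSpace I x) := LinearMap.ker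
    (hV.secondFormₗ x (S.φ x u) - (S.φ x).toLinearMap ∘ₗ hV.secondFormₗ x u)
  suffices h : Submodule.span ℝ (Set.range fun i ↦ e i x) ≤ K from
    sub_eq_zero.1 (LinearMap.mem_ker.1 (h hv))
  rw [Submodule.span_le]
  rintro _ ⟨i, rfl⟩
  refine LinearMap.mem_ker.2 (sub_eq_zero.2 ?_)
  change V.secondForm x (S.φ x u) (e i x) = S.φ x (V.secondForm x u (e i x))
  have hX : CMDiffAt ∞ (T% (e i)) x := (he.smooth i).contMDiffAt (hU.mem_nhds hx)
  have hX' := mdifferentiableAt_of_contMDiffAt hX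
  have heV {y : M} (hy : y ∈ U) : e i y ∈ V y := he.span_eq y hy ▸ Submodule.subset_span ⟨i, rfl⟩
  have hs (w : TangentSpace I x) :
      (V.orthogonal x).starProjection (leviCivita I M (e i) x w) = V.secondForm x w (e i x) := by
    -- The frame is known to lie in V only on U. Its projection is a section of V everywhere and
    -- agrees with it near x.
    have hP : MDiffAt (T% (fun y ↦ (V y).starProjection (e i y))) x :=
      mdifferentiableAt_of_contMDiffAt (hV.contMDiffAt_starProjection hX)
    have h := hV.starProjection_leviCivita hP (fun y ↦ Submodule.starProjection_apply_mem _ _) w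
    rw [Submodule.starProjection_eq_self_iff.2 (heV hx)] at h
    rw [← h, leviCivita_congr hX' hP]
    filter_upwards [hU.mem_nhds hx] with y hy
    exact (Submodule.starProjection_eq_self_iff.2 (heV hy)).symm
  have hY : CMDiffAt ∞ (T% (extend E u : Π y : M, TangentSpace I y)) x := contMDiffAt_extend I E u
  have hY' := mdifferentiableAt_of_contMDiffAt hY
  have h := congrArg (V.orthogonal x).starProjection ((hhe i).lie_φ x hx _ hY)
  have hξ0 : (V.orthogonal x).starProjection (S.ξ x) = 0 :=
    Submodule.starProjection_orthogonal_apply_eq_zero (hξ x)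
  have hX0 : (V.orthogonal x).starProjection (e i x) = 0 :=
    Submodule.starProjection_orthogonal_apply_eq_zero (heV hx)
  have ha : S.applyφ (extend E u : Π y : M, TangentSpace I y) x = S.φ x u := by
    simp only [applyφ, extend_apply_self]
  rw [map_smul, hξ0, smul_zero, ← leviCivita_sub_leviCivita hX' (S.mdifferentiableAt_applyφ hY'),
    ← leviCivita_sub_leviCivita hX' hY', hS.leviCivita_applyφ hY', ha] at h
  simp only [extend_apply_self, map_sub, map_add, map_smul, hinv.starProjection_φ, hξ0, hX0, hs,
    smul_zero] at h
  rw [← sub_eq_zero, ← neg_eq_zero, ← h]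
  abel

/-- Contact-holomorphic invariant distributions are minimal. -/
theorem IsSasakian.traceSecondFundamentalForm_eq_zero (hS : S.IsSasakian n) (hV : V.IsRegular)
    (hinv : S.IsInvariant V) (hξ : ∀ x, S.ξ x ∈ V x) {k : ℕ} (hhol : S.IsContactHolomorphic V k)
    (x : M) : V.traceSecondFundamentalForm x = 0 := by
  rw [hV.traceSecondFundamentalForm_eq_sum_secondForm]
  have h := hinv.sum_apply_φ_φ (hξ x) (hV.secondFormₗ x)
  simp only [hV.secondFormₗ_apply] at h
  have hφ (i) : V.secondForm x (S.φ x (V.basisAt x i)) (S.φ x (V.basisAt x i))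
      = - V.secondForm x (V.basisAt x i) (V.basisAt x i) := by
    rw [hS.secondForm_φ_right hV hinv hξ _ (V.basisAt_mem x i),
      hS.secondForm_φ_left hV hinv hξ hhol _ (V.basisAt_mem x i),
      φ_φ_of_mem_orthogonal (hξ x) (Distribution.secondForm_mem _ _), hinv.starProjection_φ,
      show (V.orthogonal x).starProjection (V.basisAt x i) = 0 from
        Submodule.starProjection_orthogonal_apply_eq_zero (V.basisAt_mem x i)]
    simp
  have hξξ : V.secondForm x (S.ξ x) (S.ξ x) = 0 := by
    rw [hS.secondForm_ξ hV hinv hξ, show (V.orthogonal x).starProjection (S.ξ x) = 0 from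
      Submodule.starProjection_orthogonal_apply_eq_zero (hξ x), map_zero, neg_zero]
  simp only [hφ, Finset.sum_neg_distrib, hξξ, sub_zero] at h
  have h2 : (2 : ℝ) • ∑ i, V.secondForm x (V.basisAt x i) (V.basisAt x i) = 0 := by
    rw [two_smul]
    nth_rewrite 1 [← h]
    exact neg_add_cancel _
  exact (smul_eq_zero.1 h2).resolve_left two_ne_zero

/-- Let B(v, w) = h(h(u, v), w), so B(ξ, ξ) = φ²u = -u. The φ-rules give B(φv, φv) = -B(v, v) -
2η(v) φh(u, v) + η(v)² u, and summing over the basis gives -tr B - 2u + u. Equating this with tr B -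
B(ξ, ξ) = tr B + u yields tr B = -u. -/
theorem IsSasakian.sum_secondForm_secondForm (hS : S.IsSasakian n) (hV : V.IsRegular)
    (hinv : S.IsInvariant V) (hξ : ∀ x, S.ξ x ∈ V x) {k : ℕ} (hhol : S.IsContactHolomorphic V k)
    {u : TangentSpace I x} (hu : u ∈ V.orthogonal x) :
    ∑ i, V.secondForm x (V.secondForm x u (V.basisAt x i)) (V.basisAt x i) = - u := by
  have hP {w : TangentSpace I x} (hw : w ∈ V.orthogonal x) :
      (V.orthogonal x).starProjection w = w := Submodule.starProjection_eq_self_iff.2 hw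
  have hmem {u v : TangentSpace I x} : V.secondForm x u v ∈ V.orthogonal x :=
    Distribution.secondForm_mem u v
  have h := hinv.sum_apply_φ_φ (hξ x) (hV.secondFormₗ x ∘ₗ hV.secondFormₗ x u)
  simp only [LinearMap.comp_apply, hV.secondFormₗ_apply] at h
  have hφ (i) : V.secondForm x (V.secondForm x u (S.φ x (V.basisAt x i))) (S.φ x (V.basisAt x i))
      = - V.secondForm x (V.secondForm x u (V.basisAt x i)) (V.basisAt x i)
        - (2 : ℝ) • S.φ x (V.secondForm x u (S.η x (V.basisAt x i) • V.basisAt x i))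
        + S.η x (V.basisAt x i) ^ 2 • u := by
    have hv := V.basisAt_mem x i
    rw [hS.secondForm_φ_right hV hinv hξ _ hv, hS.secondForm_φ_right hV hinv hξ _ hv, hP hu,
      map_sub, map_smul, hP hu, hP (hinv.orthogonal x _ hmem)]
    have e : V.secondForm x (S.φ x (V.secondForm x u (V.basisAt x i))
          - S.η x (V.basisAt x i) • u) (V.basisAt x i)
        = S.φ x (V.secondForm x (V.secondForm x u (V.basisAt x i)) (V.basisAt x i))
          - S.η x (V.basisAt x i) • V.secondForm x u (V.basisAt x i) := by
      rw [← hS.secondForm_φ_left hV hinv hξ hhol (V.secondForm x u _) hv]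
      simp only [← hV.secondFormₗ_apply, map_sub, map_smul, LinearMap.sub_apply,
        LinearMap.smul_apply]
    have e' : V.secondForm x u (S.η x (V.basisAt x i) • V.basisAt x i)
        = S.η x (V.basisAt x i) • V.secondForm x u (V.basisAt x i) :=
      map_smul (hV.secondFormₗ x u) _ _
    rw [e, e', map_sub, φ_φ_of_mem_orthogonal (hξ x) hmem]
    simp only [map_smul]
    module
  -- The weighted sum ∑ η(e_i) e_i is ξ.
  have hsum : ∑ i, V.secondForm x u (S.η x (V.basisAt x i) • V.basisAt x i) = - S.φ x u := by
    rw [← hP hu, ← hS.secondForm_ξ hV hinv hξ, ← sum_η_smul_basisAt (hξ x), hP hu]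
    exact (map_sum (hV.secondFormₗ x u) _ _).symm
  have hξξ : V.secondForm x (V.secondForm x u (S.ξ x)) (S.ξ x) = - u := by
    rw [hS.secondForm_ξ hV hinv hξ u, hS.secondForm_ξ hV hinv hξ, hP hu, map_neg,
      hP (hinv.orthogonal x u hu), map_neg, neg_neg, φ_φ_of_mem_orthogonal (hξ x) hu]
  simp only [hφ, hξξ, Finset.sum_add_distrib, Finset.sum_sub_distrib, Finset.sum_neg_distrib,
    ← Finset.smul_sum, ← Finset.sum_smul, ← map_sum, hsum, sum_η_basisAt_sq (hξ x), map_neg,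
    φ_φ_of_mem_orthogonal (hξ x) hu] at h
  have h2 : (2 : ℝ) • (∑ i, V.secondForm x (V.secondForm x u (V.basisAt x i)) (V.basisAt x i) + u)
      = 0 := by
    rw [← sub_eq_zero] at h
    rw [← neg_eq_zero, ← h]
    module
  exact eq_neg_of_add_eq_zero_left ((smul_eq_zero.1 h2).resolve_left two_ne_zero)

/-- By duality, for each f_a the sum over f_b is g(f_a, ∑ h(h(f_a, e_i), e_i)) = -1, so each
direction of H contributes -1. -/
theorem IsSasakian.secondFormSq_orthogonal (hS : S.IsSasakian n) (hV : V.IsRegular)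
    (hinv : S.IsInvariant V) (hξ : ∀ x, S.ξ x ∈ V x) {k : ℕ} (hhol : S.IsContactHolomorphic V k)
    (x : M) : V.orthogonal.secondFormSq x = - finrank ℝ (V.orthogonal x) := by
  have hmem {u v : TangentSpace I x} : V.secondForm x u v ∈ V.orthogonal x :=
    Distribution.secondForm_mem u v
  have hexp (u : TangentSpace I x) (v w : TangentSpace I x) :
      inner ℝ w (V.secondForm x (V.secondForm x u v) v)
        = ∑ b, inner ℝ (V.orthogonal.basisAt x b) (V.secondForm x u v)
            * inner ℝ w (V.secondForm x (V.orthogonal.basisAt x b) v) := by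
    have h := V.orthogonal.sum_inner_basisAt_smul x (V.secondForm x u v)
    rw [Submodule.starProjection_eq_self_iff.2 hmem] at h
    conv_lhs => rw [← h, ← hV.secondFormₗ_apply, map_sum, LinearMap.sum_apply, inner_sum]
    refine Finset.sum_congr rfl fun b _ ↦ ?_
    rw [map_smul, LinearMap.smul_apply, inner_smul_right, hV.secondFormₗ_apply]
  have hS' (a b i) : inner ℝ (V.orthogonal.secondForm x (V.orthogonal.basisAt x a)
        (V.orthogonal.basisAt x b)) (V.basisAt x i)
      = - inner ℝ (V.orthogonal.basisAt x b)
          (V.secondForm x (V.orthogonal.basisAt x a) (V.basisAt x i)) := by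
    have h := hV.orthogonal.inner_secondForm (V.orthogonal.basisAt x a) (V.basisAt x i)
      (V.orthogonal.basisAt_mem x b)
    rwa [Distribution.orthogonal_orthogonal] at h
  have hSV {u v : TangentSpace I x} : V.orthogonal.secondForm x u v ∈ V x := by
    have h := Distribution.secondForm_mem (D := V.orthogonal) u v
    rwa [Distribution.orthogonal_orthogonal] at h
  have ha (a) : ∑ b, inner ℝ (V.orthogonal.secondForm x (V.orthogonal.basisAt x a)
        (V.orthogonal.basisAt x b)) (V.orthogonal.secondForm x (V.orthogonal.basisAt x b)
        (V.orthogonal.basisAt x a)) = -1 := by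
    have h1 := congrArg (inner ℝ (V.orthogonal.basisAt x a))
      (hS.sum_secondForm_secondForm hV hinv hξ hhol (V.orthogonal.basisAt_mem x a))
    rw [inner_neg_right, inner_sum, real_inner_self_eq_norm_sq,
      (V.orthogonal.orthonormal_basisAt x).1 a, one_pow] at h1
    rw [← h1]
    simp only [Distribution.inner_eq_sum_basisAt_of_mem (D := V) hSV, hS', neg_mul_neg, hexp]
    rw [Finset.sum_comm]
  rw [Distribution.secondFormSq, Finset.sum_congr rfl fun a _ ↦ ha a]
  simp

/-- The Walczak formula for a contact-holomorphic invariant distribution on a Sasakian manifold. -/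
theorem IsSasakian.divergenceAlong_traceSecondFundamentalForm (hS : S.IsSasakian n)
    (hV : V.IsRegular) (hinv : S.IsInvariant V) (hξ : ∀ x, S.ξ x ∈ V x) {k : ℕ}
    (hhol : S.IsContactHolomorphic V k) (x : M) :
    V.divergenceAlong V.orthogonal.traceSecondFundamentalForm x + finrank ℝ (V.orthogonal x)
        + 1 / 4 * V.normSqIntegrabilityTensor x
      = V.mixedCurvature x + V.normSqSecondFundamentalForm x := by
  have h1 := hV.mixedCurvature_eq x
  have h2 := hV.normSq_sub_normSq x
  have h3 := hS.secondFormSq_orthogonal hV hinv hξ hhol x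
  have h4 : V.orthogonal.divergenceAlong V.traceSecondFundamentalForm x = 0 := by
    have h : V.traceSecondFundamentalForm = 0 :=
      funext (hS.traceSecondFundamentalForm_eq_zero hV hinv hξ hhol)
    refine Finset.sum_eq_zero fun a _ ↦ ?_
    rw [h, (leviCivita I M).zero]
    simp
  change _ = V.secondFormSq x at h2
  linarith

end AlmostContactMetricStructure

theorem Distribution.IsSmoothOfDim.finrank_eq {D : Distribution I M} {k : ℕ}
    (hD : D.IsSmoothOfDim k) (x : M) : finrank ℝ (D x) = k := by
  obtain ⟨U, e, hU, hx, he⟩ := hD x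
  rw [← he.span_eq x hx, finrank_span_eq_card (he.linearIndependent x hx), Fintype.card_fin]

end

end SasakiWalczak

theorem proposition5p2 (n p : ℕ)
    {M : Type*} [TopologicalSpace M] [T2Space M] [SecondCountableTopology M]
    [ChartedSpace (EuclideanSpace ℝ (Fin (2 * n + 1))) M] [IsManifold (𝓡 (2 * n + 1)) ∞ M]
    [RiemannianBundle (fun x : M ↦ TangentSpace (𝓡 (2 * n + 1)) x)]
    [IsContMDiffRiemannianBundle (𝓡 (2 * n + 1)) ∞ (EuclideanSpace ℝ (Fin (2 * n + 1)))
      (fun x : M ↦ TangentSpace (𝓡 (2 * n + 1)) x)]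
    (S : SasakiWalczak.AlmostContactMetricStructure (𝓡 (2 * n + 1)) M) (hS : S.IsSasakian n)
    (V : SasakiWalczak.Distribution (𝓡 (2 * n + 1)) M) (hV : V.IsSmoothOfDim (2 * p + 1))
    (hinv : S.IsInvariant V) (hhol : S.IsContactHolomorphic V (2 * p + 1)) :
    ContMDiff (𝓡 (2 * n + 1)) ((𝓡 (2 * n + 1)).prod 𝓘(ℝ, EuclideanSpace ℝ (Fin (2 * n + 1)))) ∞
      (fun x : M ↦ (V.orthogonal.traceSecondFundamentalForm x : TangentBundle (𝓡 (2 * n + 1)) M)) ∧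
    (∀ x : M,
      V.divergenceAlong V.orthogonal.traceSecondFundamentalForm x + 2 * ((n : ℝ) - (p : ℝ))
          + 1 / 4 * V.normSqIntegrabilityTensor x
        = V.mixedCurvature x + V.normSqSecondFundamentalForm x) ∧
    (V.IsIntegrable → ∀ x : M,
      V.divergenceAlong V.orthogonal.traceSecondFundamentalForm x + 2 * ((n : ℝ) - (p : ℝ))
        = V.mixedCurvature x + V.normSqSecondFundamentalForm x) := by
  have hodd (x : M) : Odd (finrank ℝ (V x)) := by
    rw [hV.finrank_eq x]
    exact odd_two_mul_add_one p
  have hξ (x : M) : S.ξ x ∈ V x := hinv.ξ_mem (hodd x)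
  -- The codimension (2n + 1) - (2p + 1) is computed in ℝ, which avoids truncated subtraction.
  have hrank (x : M) : (finrank ℝ (V.orthogonal x) : ℝ) = 2 * ((n : ℝ) - (p : ℝ)) := by
    have h := (V x).finrank_add_finrank_orthogonal
    have h' : finrank ℝ (TangentSpace (𝓡 (2 * n + 1)) x) = 2 * n + 1 :=
      finrank_euclideanSpace_fin
    rw [hV.finrank_eq x, h'] at h
    have h2 : (2 * (p : ℝ) + 1) + (finrank ℝ (V.orthogonal x) : ℝ) = 2 * (n : ℝ) + 1 :=
      mod_cast h
    linarith
  have hW (x : M) := hS.divergenceAlong_traceSecondFundamentalForm hV.isRegular hinv hξ hhol x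
  refine ⟨hV.isRegular.orthogonal.contMDiffAt_traceSecondFundamentalForm, fun x ↦ ?_,
    fun hint x ↦ ?_⟩
  · rw [← hrank x]
    exact hW x
  · have h := hW x
    rw [hint.normSqIntegrabilityTensor_eq_zero hV.isRegular, hrank x] at h
    linarith
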